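/- **Data.** Let $d\in\mathbb N$, $T>0$, and let $\mathcal P_1(\mathbb R^d)$ be the set of Borel probability measures on $\mathbb R^d$ with finite first moment, with the Kantorovich–Rubinstein distance $d_1$. Let $F,G:\mathbb R^d\times\mathcal P_1(\mathbb R^d)\to\mathbb R$, $L:\mathbb R^d\times\mathbb R^d\to\mathbb R$, $m_0^*\in\mathcal P_1(\mathbb R^d)$, $C_H>0$, and $\Delta=(\Delta x,\Delta t)$ with $\Delta x,\Delta t>0$, $N_T\Delta t=T$ for an integer $N_T\ge1$, and $\Delta x<c\,\Delta t$ for some $c>0$. **Grid.** For $i\in\mathbb Z^d$ put $x_i=i\Delta x$, $E_i=\{x:|x-x_i|_\infty\le\Delta x/2\}$ and $\beta_i(x)=\prod_{l=1}^d\max\{0,\,1-|x^l-x_i^l|/\Delta x\}$; for bounded $W:\mathbb Z^d\to\mathbb R$ put $I[W]=\sum_iW_i\beta_i$. Let $\mathcal S$ be the set of $z:\mathbb Z^d\to[0,\infty)$ with $\sum_iz_i=1$ and $\sum_i|i|z_i<\infty$, and let $M[z]\in\mathcal P_1(\mathbb R^d)$ have density $(\Delta x)^{-d}\sum_iz_i\mathbf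 1_{E_i}$. Put $f(x_i,z)=F(x_i,M[z])$ and $g(x_i,z)=G(x_i,M[z])$. Let $B=\{a\in\mathbb R^d:|a|_\infty\le C_H\}$ and, for bounded $v=(v_{i,k})$, $i\in\mathbb Z^d$, $0\le k\le N_T$, $$\Lambda_{i,k}[v]=\operatorname*{arg\,min}_{a\in B}\{I[v_{k+1}](x_i-\Delta t\,a)+\Delta t\,L(x_i,a)\}\quad(k<N_T).$$ Let $\Lambda_\Delta[v]$ be the set of $q=(q_{i,k})_{k<N_T}$ with $q_{i,k}\in\Lambda_{i,k}[v]$ for all $i,k$. For $\nu=(\nu_k)_{k=0}^{N_T}\in\mathcal S^{N_T+1}$, the value function of $\nu$ is the bounded $v$ with $v_{i,N_T}=g(x_i,\nu_{N_T})$ and, for $k<N_T$, $v_{i,k}=\min_{a\in B}\{I[v_{k+1}](x_i-\Delta t\,a)+\Delta t\,L(x_i,a)\}+\Delta t\,f(x_i,\nu_k)$. The transport of $m_0^*$ by $q$ is the $m$ with $m_{i,0}=m_0^*(E_i)$ and $m_{i,k+1}=\sum_j\beta_i(x_j-\Delta t\,q_{j,k})\,m_{j,k}$. A solution of the discrete mean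 field game system $(MFG^2_d)$ is a pair $(m,v)$, with $m\in\mathcal S^{N_T+1}$ and $v$ bounded, such that, for some $q\in\Lambda_\Delta[v]$, $v_{i,N_T}=g(x_i,m_{N_T})$, $v_{i,k}=I[v_{k+1}](x_i-\Delta t\,q_{i,k})+\Delta t\,L(x_i,q_{i,k})+\Delta t\,f(x_i,m_k)$ for $k<N_T$, and $m$ is the transport of $m_0^*$ by $q$. **Assumptions.** 1. $F,G$ are continuous on $\mathbb R^d\times\mathcal P_1(\mathbb R^d)$ and, for some constant, $|h(x,\nu)-h(x,\tilde\nu)|\le C\,d_1(\nu,\tilde\nu)$ for all $x,\nu,\tilde\nu$ and $h=F,G$. 2. Uniformly in $\nu$: $|F(x,\nu)|\le C$ and $|F(x,\nu)-F(y,\nu)|\le C|x-y|$; $G(\cdot,\nu)\in C^2(\mathbb R^d)$ is supported in a fixed ball and has bounded $C^2$ norm. 3. $m_0^*$ has a compactly supported $C^2$ density. 4. $L\in C^2(\mathbb R^d\times\mathbb R^d)$ is bounded below and, for constants $C_1,\dots,C_5>0$ and all $x,a,b,y\in\mathbb R^d$: $L(x,a)\le C_1|a|^2+C_2$, $|D_xL(x,a)|\le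 C_3(1+|a|^2)$, $C_4|b|^2\le\langle D^2_{aa}L(x,a)b,b\rangle$, $\langle D^2_{xx}L(x,a)y,y\rangle\le C_5(1+|a|^2)|y|^2$. 5. For $h=f,g$ and all finitely supported $z,\tilde z\in\mathcal S$: $\sum_i(h(x_i,z)-h(x_i,\tilde z))(z_i-\tilde z_i)\ge0$. 6. (Unique discrete optimal controls.) For every $\nu\in\mathcal S^{N_T+1}$ with value function $v$, each set $\Lambda_{i,k}[v]$, $i\in\mathbb Z^d$, $k<N_T$, is a singleton. **Discrete Learning Value Iteration.** Given $\bar m^{(1)}\in\mathcal S^{N_T+1}$, for $n\ge1$: let $v^{(n)}$ be the value function of $\bar m^{(n)}$, choose $q^{(n)}\in\Lambda_\Delta[v^{(n)}]$, let $m^{(n+1)}\in\mathcal S^{N_T+1}$ be the transport of $m_0^*$ by $q^{(n)}$, and put $\bar m^{(n+1)}=(1-\tfrac1{n+1})\bar m^{(n)}+\tfrac1{n+1}m^{(n+1)}$. **Theorem.** Under these assumptions $(MFG^2_d)$ has a unique solution $(m,v)$, and $\Lambda_\Delta[v]$ has a unique element $q$. For every initial guess $\bar m^{(1)}\in\mathcal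 S^{N_T+1}$ the iteration can be carried out, and every sequence that it produces satisfies $(q^{(n)},v^{(n)},m^{(n)},\bar m^{(n)})\to(q,v,m,m)$ as $n\to\infty$, in the following sense: $q^{(n)}_{i,k}\to q_{i,k}$ for all $i$ and $k<N_T$; and for each $k\le N_T$, $\sup_i|v^{(n)}_{i,k}-v_{i,k}|\to0$, $\sum_i|m^{(n)}_{i,k}-m_{i,k}|\to0$ and $\sum_i|\bar m^{(n)}_{i,k}-m_{i,k}|\to0$. -/

import Mathlib

open MeasureTheory Filter Topology

noncomputable section

namespace MFGDiscrete

/-! ### The data: state space, probability measures with finite first moment -/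

/-- The Euclidean space `ℝ^d`. -/
abbrev E (d : ℕ) : Type := EuclideanSpace ℝ (Fin d)

/-- `P₁(ℝ^d)`: Borel probability measures on `ℝ^d` with finite first moment. -/
def P1 (d : ℕ) : Type :=
  {μ : Measure (E d) // IsProbabilityMeasure μ ∧ ∫⁻ x, ‖x‖ₑ ∂μ < ⊤}

/-- The Kantorovich-Rubinstein distance `d₁`. -/
def d1 {d : ℕ} (μ ν : P1 d) : ℝ :=
  sSup {r : ℝ | ∃ φ : E d → ℝ, LipschitzWith 1 φ ∧ r = ∫ x, φ x ∂μ.1 - ∫ x, φ x ∂ν.1}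

/-- `F` is jointly continuous on `ℝ^d × (P₁(ℝ^d), d₁)`. -/
def JointlyContinuous {d : ℕ} (F : E d → P1 d → ℝ) : Prop :=
  ∀ (x : E d) (μ : P1 d) (ε : ℝ), 0 < ε → ∃ δ > 0, ∀ (y : E d) (ν : P1 d),
    ‖y - x‖ < δ → d1 ν μ < δ → |F y ν - F x μ| < ε

/-- Assumption on the running coupling: `F` is bounded, and Lipschitz in `x`, uniformly in the measure. -/
def RunningBounds {d : ℕ} (F : E d → P1 d → ℝ) : Prop :=
  ∃ C₁ > 0, ∃ C₂ > 0, ∀ μ : P1 d,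
    (∀ x, |F x μ| ≤ C₁) ∧ ∀ x y, |F x μ - F y μ| ≤ C₂ * ‖x - y‖

/-- Assumption on the terminal coupling: `G(·, μ)` is `C²`, supported in a fixed ball, and bounded in `C²`,
uniformly in the measure. -/
def TerminalBounds {d : ℕ} (G : E d → P1 d → ℝ) : Prop :=
  ∃ C₁ > 0, ∃ C₂ > 0, ∀ μ : P1 d,
    ContDiff ℝ 2 (fun x => G x μ) ∧
    tsupport (fun x => G x μ) ⊆ Metric.closedBall 0 C₁ ∧
    ∀ x, |G x μ| + ‖fderiv ℝ (fun y => G y μ) x‖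
        + ‖fderiv ℝ (fderiv ℝ (fun y => G y μ)) x‖ ≤ C₂

/-- The initial measure has a `C²` density with compact support. -/
def RegularInitial {d : ℕ} (m₀ : P1 d) : Prop :=
  ∃ ρ : E d → ℝ, ContDiff ℝ 2 ρ ∧ (∀ x, 0 ≤ ρ x) ∧
    m₀.1 = volume.withDensity (fun x => ENNReal.ofReal (ρ x)) ∧
    ∃ C > 0, tsupport ρ ⊆ Metric.closedBall 0 C

/-- The assumptions on the Lagrangian `L(x, a)`. -/
def LagrangianAssumptions {d : ℕ} (L : E d → E d → ℝ) : Prop :=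
  ContDiff ℝ 2 (fun p : E d × E d => L p.1 p.2) ∧
  (∃ C : ℝ, ∀ x a, C ≤ L x a) ∧
  ∃ C₁ > 0, ∃ C₂ > 0, ∃ C₃ > 0, ∃ C₄ > 0, ∃ C₅ > 0, ∀ x a : E d,
    L x a ≤ C₁ * ‖a‖ ^ 2 + C₂ ∧
    ‖fderiv ℝ (fun y => L y a) x‖ ≤ C₃ * (1 + ‖a‖ ^ 2) ∧
    (∀ b : E d, C₄ * ‖b‖ ^ 2 ≤ fderiv ℝ (fderiv ℝ (fun a' => L x a')) a b b) ∧
    (∀ y : E d, fderiv ℝ (fderiv ℝ (fun x' => L x' a)) x y y ≤ C₅ * (1 + ‖a‖ ^ 2) * ‖y‖ ^ 2)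

/-- Lipschitz continuity in the measure argument, with a constant independent of `x`. -/
def LipschitzInMeasure {d : ℕ} (F : E d → P1 d → ℝ) : Prop :=
  ∃ C > 0, ∀ (x : E d) (μ ν : P1 d), |F x μ - F x ν| ≤ C * d1 μ ν

/-! ### The grid -/

/-- A space-time mesh on `ℝ^d × [0, T]`: the space step `dx`, the time step `dt`, and
the number `N ≥ 1` of time steps, with `N * dt = T`. -/
structure Mesh (T : ℝ) where
  dx : ℝ
  dt : ℝ
  N : ℕ
  dx_pos : 0 < dx
  dt_pos : 0 < dt
  N_pos : 0 < N
  N_mul_dt : (N : ℝ) * dt = T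

/-- Indices `i ∈ ℤ^d` of the space grid. -/
abbrev Idx (d : ℕ) : Type := Fin d → ℤ

/-- The grid point `x_i = i Δx`. -/
def pt {d : ℕ} (h : ℝ) (i : Idx d) : E d := WithLp.toLp 2 (fun l => (i l : ℝ) * h)

/-- The cell `E_i = {x : |x - x_i|_∞ ≤ Δx / 2}`. -/
def cell {d : ℕ} (h : ℝ) (i : Idx d) : Set (E d) := {x | ∀ l, |x l - pt h i l| ≤ h / 2}

/-- The `Q₁` basis function `β_i`: the tensor product of the one-dimensional hat functions. -/
def hat {d : ℕ} (h : ℝ) (i : Idx d) (x : E d) : ℝ := ∏ l, max 0 (1 - |x l - pt h i l| / h)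

/-- The interpolation operator `I[W](x) = ∑_i W_i β_i(x)` (at most `2^d` terms are nonzero). -/
def interp {d : ℕ} (h : ℝ) (W : Idx d → ℝ) (x : E d) : ℝ := ∑' i, W i * hat h i x

/-- Grid distributions `z ∈ S(G_Δx)`: `z_i ≥ 0`, `∑_i z_i = 1`, and finite first moment, so that
the associated measure on `ℝ^d` lies in `P₁(ℝ^d)`, the domain of the couplings. -/
@[ext] structure GridProb (d : ℕ) where
  toFun : Idx d → ℝ
  nonneg : ∀ i, 0 ≤ toFun i
  hasSum : HasSum toFun 1
  moment : Summable fun i => ‖i‖ * toFun i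

instance {d : ℕ} : CoeFun (GridProb d) (fun _ => Idx d → ℝ) := ⟨GridProb.toFun⟩

/-- The measure on `ℝ^d` with density `M_Δx[z] = (Δx)^{-d} ∑_i z_i 1_{E_i}`. -/
def gridMeasure {d : ℕ} (h : ℝ) (z : Idx d → ℝ) : Measure (E d) :=
  volume.withDensity fun x =>
    ∑' i, (cell h i).indicator (fun _ => ENNReal.ofReal (1 / h ^ d * z i)) x

theorem cell_eq {d : ℕ} (h : ℝ) (i : Idx d) :
    cell h i = (WithLp.ofLp : E d → Fin d → ℝ) ⁻¹'
      (Set.Icc (fun l => (i l : ℝ) * h - h / 2) (fun l => (i l : ℝ) * h + h / 2)) := by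
  ext x
  simp only [cell, pt, Set.mem_preimage, Set.mem_Icc, Pi.le_def, abs_le, ← forall_and]
  refine forall_congr' fun l => ?_
  constructor
  · rintro ⟨h1, h2⟩
    exact ⟨by linarith, by linarith⟩
  · rintro ⟨h1, h2⟩
    exact ⟨by linarith, by linarith⟩

theorem measurableSet_cell {d : ℕ} (h : ℝ) (i : Idx d) : MeasurableSet (cell h i) := by
  rw [cell_eq]
  exact (PiLp.volume_preserving_ofLp (Fin d)).measurable measurableSet_Icc

theorem volume_cell {d : ℕ} {h : ℝ} (hh : 0 < h) (i : Idx d) :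
    volume (cell h i) = ENNReal.ofReal (h ^ d) := by
  rw [cell_eq, (PiLp.volume_preserving_ofLp (Fin d)).measure_preimage
    measurableSet_Icc.nullMeasurableSet, Real.volume_Icc_pi, ENNReal.ofReal_pow hh.le]
  rw [Finset.prod_congr rfl (g := fun _ => ENNReal.ofReal h) (fun l _ => by congr 1; ring)]
  simp

theorem gridMeasure_lintegral {d : ℕ} (h : ℝ) (z : Idx d → ℝ) (u : E d → ENNReal)
    (hu : Measurable u) :
    ∫⁻ x, u x ∂(gridMeasure h z)
      = ∑' i, ENNReal.ofReal (1 / h ^ d * z i) * ∫⁻ x in cell h i, u x := by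
  have hm : ∀ i : Idx d, Measurable
      ((cell h i).indicator (fun _ : E d => ENNReal.ofReal (1 / h ^ d * z i))) :=
    fun i => measurable_const.indicator (measurableSet_cell h i)
  rw [gridMeasure, lintegral_withDensity_eq_lintegral_mul _ (Measurable.tsum hm) hu]
  simp only [Pi.mul_apply, ← ENNReal.tsum_mul_right]
  refine (lintegral_tsum fun i => ((hm i).mul hu).aemeasurable).trans ?_
  refine tsum_congr fun i => ?_
  rw [← lintegral_const_mul _ hu, ← lintegral_indicator (measurableSet_cell h i)]
  refine lintegral_congr fun x => ?_
  by_cases hx : x ∈ cell h i <;> simp [hx]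

theorem norm_pt_le {d : ℕ} {h : ℝ} (hh : 0 < h) (i : Idx d) : ‖pt h i‖ ≤ d * h * ‖i‖ := by
  have h1 : ‖pt h i‖ ≤ ∑ l, ‖(i l : ℝ) * h‖ := by
    rw [EuclideanSpace.norm_eq]
    refine (Real.sqrt_le_sqrt (Finset.sum_sq_le_sq_sum_of_nonneg fun l _ => norm_nonneg _)).trans ?_
    rw [Real.sqrt_sq (Finset.sum_nonneg fun l _ => norm_nonneg _)]
    rfl
  refine h1.trans ?_
  calc ∑ l, ‖(i l : ℝ) * h‖ ≤ ∑ _l : Fin d, ‖i‖ * h := by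
        refine Finset.sum_le_sum fun l _ => ?_
        rw [norm_mul, Real.norm_of_nonneg hh.le]
        refine mul_le_mul_of_nonneg_right ?_ hh.le
        have := norm_le_pi_norm i l
        rwa [← Int.norm_cast_real] at this
    _ = d * h * ‖i‖ := by simp; ring

theorem norm_le_of_mem_cell {d : ℕ} {h : ℝ} (hh : 0 < h) {i : Idx d} {x : E d}
    (hx : x ∈ cell h i) : ‖x‖ ≤ d * h * ‖i‖ + d * h := by
  have h1 : ‖x - pt h i‖ ≤ ∑ l, ‖x l - pt h i l‖ := by
    rw [EuclideanSpace.norm_eq]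
    refine (Real.sqrt_le_sqrt (Finset.sum_sq_le_sq_sum_of_nonneg fun l _ => norm_nonneg _)).trans ?_
    rw [Real.sqrt_sq (Finset.sum_nonneg fun l _ => norm_nonneg _)]
    rfl
  have h2 : ∑ l, ‖x l - pt h i l‖ ≤ ∑ _l : Fin d, h :=
    Finset.sum_le_sum fun l _ => (hx l).trans (by linarith)
  have h3 : ‖x‖ ≤ ‖pt h i‖ + ‖x - pt h i‖ := norm_le_insert' x (pt h i)
  have h4 := norm_pt_le hh i
  simp only [Finset.sum_const, Finset.card_univ, Fintype.card_fin, nsmul_eq_mul] at h2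
  linarith

theorem gridMeasure_mem {d : ℕ} {h : ℝ} (hh : 0 < h) (z : GridProb d) :
    IsProbabilityMeasure (gridMeasure h z) ∧ ∫⁻ x, ‖x‖ₑ ∂(gridMeasure h z) < ⊤ := by
  have hv : ∀ i : Idx d,
      ENNReal.ofReal (1 / h ^ d * z i) * volume (cell h i) = ENNReal.ofReal (z i) := by
    intro i
    rw [volume_cell hh, ← ENNReal.ofReal_mul
      (mul_nonneg (by positivity) (z.nonneg i))]
    congr 1
    have : h ^ d ≠ 0 := by positivity
    field_simp
  constructor
  · constructor
    have := gridMeasure_lintegral h z (fun _ => 1) measurable_const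
    simp only [lintegral_const, one_mul, Measure.restrict_apply_univ, hv] at this
    rw [this, ← ENNReal.ofReal_tsum_of_nonneg z.nonneg z.hasSum.summable, z.hasSum.tsum_eq,
      ENNReal.ofReal_one]
  · rw [gridMeasure_lintegral h z _ measurable_enorm]
    have hs : Summable fun i => z i * (d * h * ‖i‖ + d * h) := by
      have := (z.moment.mul_left (d * h)).add (z.hasSum.summable.mul_left (d * h))
      refine this.congr fun i => ?_
      ring
    refine lt_of_le_of_lt (ENNReal.tsum_le_tsum (g := fun i =>
      ENNReal.ofReal (z i * (d * h * ‖i‖ + d * h))) fun i => ?_) ?_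
    · have hb : ∫⁻ x in cell h i, ‖x‖ₑ ≤ ENNReal.ofReal (d * h * ‖i‖ + d * h) * volume (cell h i) := by
        rw [← setLIntegral_const]
        refine setLIntegral_mono measurable_const fun x hx => ?_
        rw [← ofReal_norm]
        exact ENNReal.ofReal_le_ofReal (norm_le_of_mem_cell hh hx)
      calc _ ≤ ENNReal.ofReal (1 / h ^ d * z i) *
            (ENNReal.ofReal (d * h * ‖i‖ + d * h) * volume (cell h i)) := by gcongr
        _ = ENNReal.ofReal (z i) * ENNReal.ofReal (d * h * ‖i‖ + d * h) := by
            rw [← hv i]; ring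
        _ = _ := (ENNReal.ofReal_mul (z.nonneg i)).symm
    · rw [← ENNReal.ofReal_tsum_of_nonneg (fun i => mul_nonneg (z.nonneg i) (by positivity)) hs]
      exact ENNReal.ofReal_lt_top

/-- `M_Δx[z]` as an element of `P₁(ℝ^d)`. -/
def toP1 {d : ℕ} {T : ℝ} (Δ : Mesh T) (z : GridProb d) : P1 d :=
  ⟨gridMeasure Δ.dx z, gridMeasure_mem Δ.dx_pos z⟩

/-- The discrete couplings `f(x_i, z) = F(x_i, M_Δx[z])`, `g(x_i, z) = G(x_i, M_Δx[z])`. -/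
def onGrid {d : ℕ} {T : ℝ} (Δ : Mesh T) (F : E d → P1 d → ℝ) (i : Idx d) (z : GridProb d) : ℝ :=
  F (pt Δ.dx i) (toP1 Δ z)

/-- Discrete Lasry-Lions monotonicity, for distributions of compact
(that is, finite) support on the grid. -/
def DiscreteMonotone {d : ℕ} {T : ℝ} (Δ : Mesh T) (F : E d → P1 d → ℝ) : Prop :=
  ∀ z z' : GridProb d, (Function.support z).Finite → (Function.support z').Finite →
    0 ≤ ∑' i, (onGrid Δ F i z - onGrid Δ F i z') * (z i - z' i)

/-! ### The fully discrete scheme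

Grid functions on `G_Δ` are indexed by `k : Fin (N + 1)` (time) and `i : Idx d` (space); functions
on `G_Δ^*`, which omits the final time, by `k : Fin N` and `i`. -/

/-- The set of controls `{a : |a|_∞ ≤ R}`. -/
def controls (d : ℕ) (R : ℝ) : Set (E d) := {a | ∀ l, |a l| ≤ R}

/-- The discrete cost `a ↦ I[W](x_i - Δt a) + Δt L(x_i, a)`, where `W` is the value function
at the next time. -/
def stepCost {d : ℕ} {T : ℝ} (Δ : Mesh T) (L : E d → E d → ℝ) (W : Idx d → ℝ) (i : Idx d)
    (a : E d) : ℝ :=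
  interp Δ.dx W (pt Δ.dx i - Δ.dt • a) + Δ.dt * L (pt Δ.dx i) a

/-- The set `Λ_{i,k}[v]` of discrete optimal controls, `R` being the bound `C_H` on the controls. -/
def optControls {d : ℕ} {T : ℝ} (Δ : Mesh T) (L : E d → E d → ℝ) (R : ℝ)
    (v : Fin (Δ.N + 1) → Idx d → ℝ) (k : Fin Δ.N) (i : Idx d) : Set (E d) :=
  {a | a ∈ controls d R ∧ IsMinOn (stepCost Δ L (v k.succ) i) (controls d R) a}

/-- The set `Λ_Δ[v]` of grid functions of discrete optimal controls. -/
def optFeedbacks {d : ℕ} {T : ℝ} (Δ : Mesh T) (L : E d → E d → ℝ) (R : ℝ)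
    (v : Fin (Δ.N + 1) → Idx d → ℝ) : Set (Fin Δ.N → Idx d → E d) :=
  {q | ∀ k i, q k i ∈ optControls Δ L R v k i}

/-- `v ∈ B(G_Δ)`. -/
def BddGrid {d : ℕ} {n : ℕ} (v : Fin n → Idx d → ℝ) : Prop := ∃ C : ℝ, ∀ k i, |v k i| ≤ C

/-- `v ∈ B(G_Δ)` solves the discrete Hamilton-Jacobi-Bellman equation associated with `ν`. -/
def SolvesHJB {d : ℕ} {T : ℝ} (Δ : Mesh T) (L : E d → E d → ℝ) (F G : E d → P1 d → ℝ) (R : ℝ)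
    (ν : Fin (Δ.N + 1) → GridProb d) (v : Fin (Δ.N + 1) → Idx d → ℝ) : Prop :=
  BddGrid v ∧
  (∀ (k : Fin Δ.N) (i : Idx d),
    v k.castSucc i = sInf (stepCost Δ L (v k.succ) i '' controls d R)
      + Δ.dt * onGrid Δ F i (ν k.castSucc)) ∧
  ∀ i, v (Fin.last Δ.N) i = onGrid Δ G i (ν (Fin.last Δ.N))

/-- `m` is the discrete transport of `m₀` by the feedback control `q`. -/
def SolvesCE {d : ℕ} {T : ℝ} (Δ : Mesh T) (m₀ : P1 d) (q : Fin Δ.N → Idx d → E d)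
    (m : Fin (Δ.N + 1) → GridProb d) : Prop :=
  (∀ (k : Fin Δ.N) (i : Idx d),
    m k.succ i = ∑' j, hat Δ.dx i (pt Δ.dx j - Δ.dt • q k j) * m k.castSucc j) ∧
  ∀ i, m 0 i = m₀.1.real (cell Δ.dx i)

/-- Uniqueness of the discrete optimal controls, at every grid point, for the value function
of every (time-dependent) grid distribution. -/
def UniqueControls {d : ℕ} {T : ℝ} (Δ : Mesh T) (L : E d → E d → ℝ) (F G : E d → P1 d → ℝ)
    (R : ℝ) : Prop :=
  ∀ (ν : Fin (Δ.N + 1) → GridProb d) (v : Fin (Δ.N + 1) → Idx d → ℝ),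
    SolvesHJB Δ L F G R ν v → ∀ k i, ∃! a, a ∈ optControls Δ L R v k i

/-- `(m, v)` solves the discrete mean field game system. -/
def SolvesMFG {d : ℕ} {T : ℝ} (Δ : Mesh T) (L : E d → E d → ℝ) (F G : E d → P1 d → ℝ)
    (m₀ : P1 d) (R : ℝ) (m : Fin (Δ.N + 1) → GridProb d) (v : Fin (Δ.N + 1) → Idx d → ℝ) : Prop :=
  BddGrid v ∧ ∃ q ∈ optFeedbacks Δ L R v,
    (∀ (k : Fin Δ.N) (i : Idx d),
      v k.castSucc i = stepCost Δ L (v k.succ) i (q k i) + Δ.dt * onGrid Δ F i (m k.castSucc)) ∧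
    (∀ i, v (Fin.last Δ.N) i = onGrid Δ G i (m (Fin.last Δ.N))) ∧
    SolvesCE Δ m₀ q m

/-- The Discrete Learning Value Iteration. For `n ≥ 1`: `v n` is the value function of `mbar n`,
`q n` an optimal control for it, `m (n + 1)` the distribution transported by `q n`, and
`mbar (n + 1) = (1 - 1/(n+1)) mbar n + 1/(n+1) m (n+1)`. The iteration starts from `mbar 1`;
`m 1` and the entries of index `0` are not used. -/
def IsDLVI {d : ℕ} {T : ℝ} (Δ : Mesh T) (L : E d → E d → ℝ) (F G : E d → P1 d → ℝ)
    (m₀ : P1 d) (R : ℝ) (q : ℕ → Fin Δ.N → Idx d → E d) (v : ℕ → Fin (Δ.N + 1) → Idx d → ℝ)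
    (m mbar : ℕ → Fin (Δ.N + 1) → GridProb d) : Prop :=
  ∀ n, 1 ≤ n →
    SolvesHJB Δ L F G R (mbar n) (v n) ∧
    q n ∈ optFeedbacks Δ L R (v n) ∧
    SolvesCE Δ m₀ (q n) (m (n + 1)) ∧
    ∀ k i, mbar (n + 1) k i
      = (1 - 1 / ((n : ℝ) + 1)) * mbar n k i + 1 / ((n : ℝ) + 1) * m (n + 1) k i

end MFGDiscrete

end

noncomputable section

namespace MFGDiscrete

section

/-! ### Minimizers on compact sets -/

/-! The argument is that of fictitious play for a monotone game. Interpolation of a value function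
is adjoint to the transport of mass by the same hat weights. Hence, for the value function `v` of
any flow `ν`, and any admissible feedback `q` with transport `m`, the control cost of `q` plus the
coupling cost of `m` at `ν` equals the mean of `v` at time 0 plus `gap`, the nonnegative excess cost
of `q` (`cost_eq_meanValue_add_gap`). Uniqueness of optimal controls and compactness of the control
set turn this excess into a distance: transports differ by at most `η + C * gap` from the optimal
one (`exists_transport_stability`). It follows that best responses depend continuously on `ν`, and
that monotonicity leaves room for at most one solution (`solution_unique`).

For the iteration, let `ν p` be the current average and `m p` its best response. Monotonicity,
optimality of `m p` for `ν p`, and linearity of the coupling cost in the transported flow show that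
`excess` grows in one step by at most `(p + 2)` times a mixed difference of coupling costs. That
difference is at most a constant times `flowDist (ν (p + 1)) (ν p) * boxDist (m p) (m (p + 1))`. The
first factor is `O(1/p)`; the second tends to 0 by continuity of the best response. The increments
are thus bounded above by a null sequence, and their Cesàro means with them. Up to terms bounded on
the relevant side, `excess` is the sum of the gaps of all past responses for the current value
function, so the mean gap tends to 0 (`tendsto_mean_gap`).

The averages are dominated by a fixed function with finite first moment, so they converge along
every ultrafilter finer than `atTop`. By stability a vanishing mean gap forces each limit to be its
own best response (`limit_eq_response`). This gives existence of a solution without a fixed point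
theorem, and uniqueness then gives convergence of the whole sequence. -/

theorem exists_le_add_mul_of_min {X : Type*} [TopologicalSpace X] [T2Space X] {K : Set X}
    (hK : IsCompact K) {c D : X → ℝ} (hc : ContinuousOn c K) (hD : ContinuousOn D K) {μ : ℝ}
    (hmin : ∀ a ∈ K, μ ≤ c a) (h0 : ∀ a ∈ K, c a = μ → D a ≤ 0) {η : ℝ} (hη : 0 < η) :
    ∃ C, 0 ≤ C ∧ ∀ a ∈ K, D a ≤ η + C * (c a - μ) := by
  have hcl : IsClosed (K ∩ D ⁻¹' Set.Ici η) :=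
    hD.preimage_isClosed_of_isClosed hK.isClosed isClosed_Ici
  have hcpt : IsCompact (K ∩ D ⁻¹' Set.Ici η) := hK.of_isClosed_subset hcl Set.inter_subset_left
  rcases (K ∩ D ⁻¹' Set.Ici η).eq_empty_or_nonempty with he | hne
  · refine ⟨0, le_rfl, fun a ha => ?_⟩
    by_contra! hcon
    have : a ∈ K ∩ D ⁻¹' Set.Ici η := ⟨ha, by simp at hcon ⊢; exact hcon.le⟩
    rw [he] at this
    exact this
  -- No minimizer of `c` lies in the compact set `{D ≥ η}`, so `c` exceeds `μ` there by a fixed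
  -- positive amount. The constant is the maximum of `D` divided by that amount.
  · obtain ⟨a₀, ha₀, hm₀⟩ := hcpt.exists_isMinOn hne (hc.mono Set.inter_subset_left)
    obtain ⟨b, hb, hM⟩ := hcpt.exists_isMaxOn hne (hD.mono Set.inter_subset_left)
    have hpos : 0 < c a₀ - μ := by
      refine lt_of_le_of_ne (sub_nonneg.2 (hmin _ ha₀.1)) fun h => ?_
      have h1 := h0 a₀ ha₀.1 (by linarith)
      have h2 : η ≤ D a₀ := ha₀.2
      linarith
    have hDb : η ≤ D b := hb.2
    have hC : 0 ≤ D b / (c a₀ - μ) := div_nonneg (hη.le.trans hDb) hpos.le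
    refine ⟨D b / (c a₀ - μ), hC, fun a ha => ?_⟩
    have hca : 0 ≤ c a - μ := sub_nonneg.2 (hmin a ha)
    by_cases hDa : η ≤ D a
    · have h1 : D a ≤ D b := hM ⟨ha, hDa⟩
      have h2 : c a₀ ≤ c a := hm₀ ⟨ha, hDa⟩
      have h3 : D b / (c a₀ - μ) * (c a₀ - μ) ≤ D b / (c a₀ - μ) * (c a - μ) :=
        mul_le_mul_of_nonneg_left (by linarith) hC
      rw [div_mul_cancel₀ _ hpos.ne'] at h3
      linarith
    · have := mul_nonneg hC hca
      linarith

/-! ### The hat functions -/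

variable {d : ℕ}

theorem pt_apply (h : ℝ) (i : Idx d) (l : Fin d) : pt h i l = (i l : ℝ) * h := rfl

theorem hat_nonneg (h : ℝ) (i : Idx d) (x : E d) : 0 ≤ hat h i x :=
  Finset.prod_nonneg fun _ _ => le_max_left _ _

theorem hat_eq_zero {h : ℝ} (hh : 0 < h) {i : Idx d} {x : E d} {l : Fin d}
    (hl : h ≤ |x l - i l * h|) : hat h i x = 0 := by
  refine Finset.prod_eq_zero (Finset.mem_univ l) (max_eq_left ?_)
  rw [pt_apply, sub_nonpos, le_div_iff₀ hh]
  linarith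

theorem continuous_hat (h : ℝ) (i : Idx d) : Continuous (hat h i) := by
  unfold hat
  fun_prop

theorem sum_hat_one_dim {h : ℝ} (hh : 0 < h) (y : ℝ) :
    ∑ j ∈ ({⌊y / h⌋, ⌊y / h⌋ + 1} : Finset ℤ), max 0 (1 - |y - j * h| / h) = 1 := by
  rw [Finset.sum_pair (by simp)]
  have key : ∀ j : ℤ, |y - j * h| / h = |y / h - j| := fun j => by
    rw [← abs_of_pos hh, ← abs_div, abs_of_pos hh]
    congr 1
    field_simp
  rw [key, key]
  have h1 := Int.floor_le (y / h)
  have h2 := Int.lt_floor_add_one (y / h)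
  push_cast
  rw [abs_of_nonneg (by linarith), abs_of_nonpos (by linarith), max_eq_right (by linarith),
    max_eq_right (by linarith)]
  ring

/-- The indices of the vertices of a cube of the grid containing `x`. -/
def vertices (h : ℝ) (x : E d) : Finset (Idx d) :=
  Fintype.piFinset fun l => {⌊x l / h⌋, ⌊x l / h⌋ + 1}

theorem hat_eq_zero_of_notMem_vertices {h : ℝ} (hh : 0 < h) {i : Idx d} {x : E d}
    (hi : i ∉ vertices h x) : hat h i x = 0 := by
  simp only [vertices, Fintype.mem_piFinset, not_forall] at hi
  obtain ⟨l, hl⟩ := hi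
  refine hat_eq_zero hh (l := l) ?_
  have hx : x l - i l * h = (x l / h - i l) * h := by field_simp
  rw [hx, abs_mul, abs_of_pos hh]
  refine le_mul_of_one_le_left hh.le ?_
  have h1 := Int.floor_le (x l / h)
  have h2 := Int.lt_floor_add_one (x l / h)
  simp only [Finset.mem_insert, Finset.mem_singleton, not_or] at hl
  rcases lt_or_ge (i l) ⌊x l / h⌋ with h3 | h3
  · have : ((i l + 1 : ℤ) : ℝ) ≤ ⌊x l / h⌋ := by exact_mod_cast h3
    push_cast at this
    rw [le_abs]; left; linarith
  · have h4 : ⌊x l / h⌋ + 2 ≤ i l := by omega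
    have : ((⌊x l / h⌋ + 2 : ℤ) : ℝ) ≤ i l := by exact_mod_cast h4
    push_cast at this
    rw [le_abs]; right; linarith

theorem sum_hat_vertices {h : ℝ} (hh : 0 < h) (x : E d) : ∑ i ∈ vertices h x, hat h i x = 1 := by
  unfold vertices hat
  simp only [pt_apply]
  rw [← Finset.prod_univ_sum (fun l => ({⌊x l / h⌋, ⌊x l / h⌋ + 1} : Finset ℤ))
    (fun l j => max 0 (1 - |x l - j * h| / h))]
  exact Finset.prod_eq_one fun l _ => sum_hat_one_dim hh (x l)

theorem interp_eq_sum {h : ℝ} {W : Idx d → ℝ} {x : E d} {S : Finset (Idx d)}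
    (hS : ∀ i ∉ S, hat h i x = 0) : interp h W x = ∑ i ∈ S, W i * hat h i x :=
  tsum_eq_sum fun i hi => by rw [hS i hi, mul_zero]

/-- Both this sum and the one over `vertices` compute the interpolation of the constant 1. The
freedom in `S` allows one index set to serve all controls at once. -/
theorem sum_hat_eq_one {h : ℝ} (hh : 0 < h) {x : E d} {S : Finset (Idx d)}
    (hS : ∀ i ∉ S, hat h i x = 0) : ∑ i ∈ S, hat h i x = 1 := by
  have h1 := interp_eq_sum (W := fun _ => 1) hS
  have h2 := interp_eq_sum (h := h) (W := fun _ => 1) (x := x)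
    fun i hi => hat_eq_zero_of_notMem_vertices hh hi
  simp only [one_mul] at h1 h2
  rw [← h1, h2, sum_hat_vertices hh]

/-- Interpolated values are convex combinations, so interpolation does not expand the sup norm. All
stability of the dynamic programming step comes from this. -/
theorem abs_interp_sub_le {h : ℝ} (hh : 0 < h) {W W' : Idx d → ℝ} {ε : ℝ}
    (hW : ∀ i, |W i - W' i| ≤ ε) (x : E d) : |interp h W x - interp h W' x| ≤ ε := by
  have hS : ∀ i ∉ vertices h x, hat h i x = 0 :=
    fun i hi => hat_eq_zero_of_notMem_vertices hh hi
  rw [interp_eq_sum hS, interp_eq_sum hS, ← Finset.sum_sub_distrib]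
  calc |∑ i ∈ vertices h x, (W i * hat h i x - W' i * hat h i x)|
      ≤ ∑ i ∈ vertices h x, |W i * hat h i x - W' i * hat h i x| := Finset.abs_sum_le_sum_abs _ _
    _ ≤ ∑ i ∈ vertices h x, ε * hat h i x := by
        refine Finset.sum_le_sum fun i _ => ?_
        rw [← sub_mul, abs_mul, abs_of_nonneg (hat_nonneg h i x)]
        exact mul_le_mul_of_nonneg_right (hW i) (hat_nonneg h i x)
    _ = ε := by rw [← Finset.mul_sum, sum_hat_vertices hh, mul_one]

theorem abs_interp_le {h : ℝ} (hh : 0 < h) {W : Idx d → ℝ} {C : ℝ}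
    (hW : ∀ i, |W i| ≤ C) (x : E d) : |interp h W x| ≤ C := by
  have h0 : interp h (fun _ => 0) x = 0 := by simp [interp]
  simpa [h0] using abs_interp_sub_le hh (W := W) (W' := fun _ => 0) (by simpa using hW) x

/-! ### Boxes of indices and the reach of one time step -/

/-- The indices with all components bounded by `b`. -/
def box (d : ℕ) (b : ℤ) : Finset (Idx d) := Finset.Icc (fun _ => -b) (fun _ => b)

theorem mem_box {b : ℤ} {i : Idx d} : i ∈ box d b ↔ ∀ l, |i l| ≤ b := by
  simp [box, Finset.mem_Icc, Pi.le_def, abs_le, forall_and]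

/-- The indices within distance `r` of `j`. -/
def nearby (r : ℤ) (j : Idx d) : Finset (Idx d) := Finset.Icc (fun l => j l - r) (fun l => j l + r)

theorem mem_nearby {r : ℤ} {i j : Idx d} : i ∈ nearby r j ↔ ∀ l, |i l - j l| ≤ r := by
  simp only [nearby, Finset.mem_Icc, Pi.le_def, ← forall_and, abs_le]
  exact forall_congr' fun l => by constructor <;> rintro ⟨h1, h2⟩ <;> constructor <;> linarith

theorem nearby_subset_box {r b : ℤ} {j : Idx d} (hj : j ∈ box d b) :
    nearby r j ⊆ box d (b + r) := by
  intro i hi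
  rw [mem_nearby] at hi
  rw [mem_box] at hj ⊢
  intro l
  have h1 := hi l
  have h2 := hj l
  rw [abs_le] at *
  constructor <;> linarith

variable {T : ℝ}

/-- How far, in number of cells, a grid point is transported in one time step. -/
def reach (Δ : Mesh T) (R : ℝ) : ℤ := ⌈Δ.dt * R / Δ.dx⌉ + 1

theorem hat_eq_zero_of_notMem_nearby (Δ : Mesh T) {R : ℝ} {a : E d} (ha : a ∈ controls d R)
    {i j : Idx d} (hi : i ∉ nearby (reach Δ R) j) :
    hat Δ.dx i (pt Δ.dx j - Δ.dt • a) = 0 := by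
  rw [mem_nearby, not_forall] at hi
  obtain ⟨l, hl⟩ := hi
  refine hat_eq_zero Δ.dx_pos (l := l) ?_
  have h1 : ((reach Δ R : ℤ) : ℝ) + 0 < |(i l : ℝ) - j l| := by
    rw [add_zero]; exact_mod_cast not_le.1 hl
  -- The `+ 1` in `reach` accounts for the radius, one cell, of the support of a hat function.
  have h2 : Δ.dt * R / Δ.dx + 1 ≤ reach Δ R := by
    simp only [reach]; push_cast; linarith [Int.le_ceil (Δ.dt * R / Δ.dx)]
  have hdx := Δ.dx_pos
  have h3 : (Δ.dt * R / Δ.dx + 1) * Δ.dx ≤ |(i l : ℝ) - j l| * Δ.dx :=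
    mul_le_mul_of_nonneg_right (by linarith) hdx.le
  have h4 : (Δ.dt * R / Δ.dx + 1) * Δ.dx = Δ.dt * R + Δ.dx := by field_simp
  have h5 : |(i l : ℝ) - j l| * Δ.dx = |j l * Δ.dx - i l * Δ.dx| := by
    rw [← sub_mul, abs_mul, abs_of_pos hdx, abs_sub_comm]
  have h6 : |Δ.dt * a l| ≤ Δ.dt * R := by
    rw [abs_mul, abs_of_pos Δ.dt_pos]
    exact mul_le_mul_of_nonneg_left (ha l) Δ.dt_pos.le
  have h7 : (pt Δ.dx j - Δ.dt • a) l - i l * Δ.dx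
      = (j l * Δ.dx - i l * Δ.dx) - Δ.dt * a l := by
    simp [pt_apply]; ring
  rw [h7]
  have := abs_sub_abs_le_abs_sub (j l * Δ.dx - i l * Δ.dx) (Δ.dt * a l)
  linarith

theorem isCompact_controls (d : ℕ) (R : ℝ) : IsCompact (controls d R) := by
  have : controls d R = WithLp.toLp 2 '' (Set.univ.pi fun _ : Fin d => Set.Icc (-R) R) := by
    ext a
    simp only [controls, Set.mem_ofPred_eq, Set.mem_image, Set.mem_univ_pi, Set.mem_Icc, abs_le]
    constructor
    · exact fun h => ⟨a.ofLp, h, rfl⟩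
    · rintro ⟨b, hb, rfl⟩
      exact hb
  rw [this]
  exact (isCompact_univ_pi fun _ => isCompact_Icc).image (PiLp.continuous_toLp 2 _)

theorem zero_mem_controls {R : ℝ} (hR : 0 < R) : (0 : E d) ∈ controls d R := by
  intro l; simp [hR.le]

/-- On the admissible controls the interpolation series reduces to a sum over one finite set of
indices, independent of the control. -/
theorem continuousOn_stepCost (Δ : Mesh T) {L : E d → E d → ℝ}
    (hL : ContDiff ℝ 2 (fun p : E d × E d => L p.1 p.2)) (R : ℝ) (W : Idx d → ℝ) (i : Idx d) :
    ContinuousOn (stepCost Δ L W i) (controls d R) := by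
  have hLc : Continuous fun a => L (pt Δ.dx i) a :=
    hL.continuous.comp (continuous_const.prodMk continuous_id)
  refine ContinuousOn.add (ContinuousOn.congr
    (f := fun a => ∑ j ∈ nearby (reach Δ R) i, W j * hat Δ.dx j (pt Δ.dx i - Δ.dt • a)) ?_
    fun a ha => interp_eq_sum fun j hj => hat_eq_zero_of_notMem_nearby Δ ha hj)
    (continuous_const.mul hLc).continuousOn
  refine (continuous_finsetSum _ fun j _ => continuous_const.mul
    ((continuous_hat _ _).comp ?_)).continuousOn
  fun_prop

end

section

variable {d : ℕ} {T : ℝ}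

/-! ### Weighted distance of grid distributions -/

/-- The `ℓ¹` distance of grid distributions with weight `1 + |i|`. -/
def wdist (z z' : GridProb d) : ℝ := ∑' i, (1 + ‖i‖) * |z i - z' i|

theorem GridProb.summable_weight (z : GridProb d) : Summable fun i => (1 + ‖i‖) * z i :=
  (z.hasSum.summable.add z.moment).congr fun i => by ring

theorem summable_wdist (z z' : GridProb d) : Summable fun i => (1 + ‖i‖) * |z i - z' i| := by
  refine Summable.of_nonneg_of_le (fun i => by positivity) (fun i => ?_)
    (z.summable_weight.add z'.summable_weight)
  rw [← mul_add]
  refine mul_le_mul_of_nonneg_left ?_ (by positivity)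
  have := abs_sub (z i) (z' i)
  rwa [abs_of_nonneg (z.nonneg i), abs_of_nonneg (z'.nonneg i)] at this

theorem wdist_nonneg (z z' : GridProb d) : 0 ≤ wdist z z' := tsum_nonneg fun i => by positivity

theorem wdist_triangle (z z' z'' : GridProb d) : wdist z z'' ≤ wdist z z' + wdist z' z'' := by
  unfold wdist
  rw [← (summable_wdist z z').tsum_add (summable_wdist z' z'')]
  refine (summable_wdist z z'').tsum_le_tsum (fun i => ?_)
    ((summable_wdist z z').add (summable_wdist z' z''))
  rw [← mul_add]
  exact mul_le_mul_of_nonneg_left (abs_sub_le _ _ _) (by positivity)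

theorem summable_abs_sub (z z' : GridProb d) : Summable fun i => |z i - z' i| :=
  (z.hasSum.summable.sub z'.hasSum.summable).abs

theorem tsum_abs_sub_le_wdist (z z' : GridProb d) : ∑' i, |z i - z' i| ≤ wdist z z' :=
  (summable_abs_sub z z').tsum_le_tsum
    (fun i => le_mul_of_one_le_left (abs_nonneg _) (by linarith [norm_nonneg i]))
    (summable_wdist z z')

theorem abs_sub_le_wdist (z z' : GridProb d) (i : Idx d) : |z i - z' i| ≤ wdist z z' :=
  ((summable_abs_sub z z').le_tsum i fun _ _ => abs_nonneg _).trans (tsum_abs_sub_le_wdist z z')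

theorem GridProb.le_one (z : GridProb d) (i : Idx d) : z i ≤ 1 := by
  rw [← z.hasSum.tsum_eq]
  exact z.hasSum.summable.le_tsum i fun _ _ => z.nonneg _

/-- Dominated convergence: a majorant with finite first moment upgrades entrywise convergence, which
is all that compactness supplies, to convergence in `wdist`. -/
theorem tendsto_wdist_of_dominated {α : Type*} {l : Filter α} {z : α → GridProb d}
    {z' : GridProb d} {b : Idx d → ℝ} (hb : Summable fun i => (1 + ‖i‖) * b i)
    (hdom : ∀ᶠ n in l, ∀ i, |z n i - z' i| ≤ b i)
    (hlim : ∀ i, Tendsto (fun n => z n i) l (𝓝 (z' i))) :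
    Tendsto (fun n => wdist (z n) z') l (𝓝 0) := by
  have := tendsto_tsum_of_dominated_convergence (𝓕 := l)
    (f := fun n i => (1 + ‖i‖) * |z n i - z' i|) (g := fun _ => 0) hb ?_ ?_
  · simpa [wdist] using this
  · intro i
    have h1 : Tendsto (fun n => z n i - z' i) l (𝓝 0) := by
      simpa using (hlim i).sub_const (z' i)
    simpa using h1.abs.const_mul (1 + ‖i‖)
  · filter_upwards [hdom] with n hn i
    rw [Real.norm_of_nonneg (by positivity)]
    exact mul_le_mul_of_nonneg_left (hn i) (by positivity)

/-! ### Comparison with the Kantorovich-Rubinstein distance -/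

theorem gridMeasure_eq_sum (h : ℝ) (z : Idx d → ℝ) :
    gridMeasure h z
      = Measure.sum fun i => ENNReal.ofReal (1 / h ^ d * z i) • volume.restrict (cell h i) := by
  refine Measure.ext_of_lintegral _ fun u hu => ?_
  rw [gridMeasure_lintegral h z u hu, lintegral_sum_measure]
  exact tsum_congr fun i => by rw [lintegral_smul_measure, smul_eq_mul]

theorem hasSum_integral_gridMeasure {h : ℝ} (hh : 0 < h) (z : GridProb d) {φ : E d → ℝ}
    (hφ : Integrable φ (gridMeasure h z)) :
    HasSum (fun i => z i * (1 / h ^ d * ∫ x in cell h i, φ x)) (∫ x, φ x ∂gridMeasure h z) := by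
  rw [gridMeasure_eq_sum] at hφ ⊢
  refine (hasSum_integral_measure hφ).congr_fun fun i => ?_
  have := z.nonneg i
  rw [integral_smul_measure, ENNReal.toReal_ofReal (by positivity), smul_eq_mul]
  ring

/-- Both measures have mass 1, so a test function `φ` may be replaced by `φ - φ 0`, which is bounded
by `‖x‖`. Its mean over the cell of index `i` is at most `d * Δx * (1 + ‖i‖)`, whence the weight in
`wdist`. -/
theorem d1_toP1_le (Δ : Mesh T) (z z' : GridProb d) :
    d1 (toP1 Δ z) (toP1 Δ z') ≤ d * Δ.dx * wdist z z' := by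
  have hh := Δ.dx_pos
  have hnn := wdist_nonneg z z'
  refine Real.sSup_le ?_ (by positivity)
  rintro r ⟨φ, hφ, rfl⟩
  have hψ : ∀ x, ‖φ x - φ 0‖ ≤ ‖x‖ := fun x => by
    simpa [dist_eq_norm] using hφ.dist_le_mul x 0
  have hint : ∀ y : GridProb d, Integrable (fun x => φ x - φ 0) (gridMeasure Δ.dx y) := fun y => by
    have hid : Integrable (fun x : E d => x) (gridMeasure Δ.dx y) :=
      ⟨measurable_id.aestronglyMeasurable, (gridMeasure_mem hh y).2⟩
    exact hid.mono (hφ.continuous.sub continuous_const).aestronglyMeasurable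
      (Eventually.of_forall hψ)
  have hsub : ∀ y : GridProb d, ∫ x, (φ x - φ 0) ∂gridMeasure Δ.dx y
      = ∫ x, φ x ∂gridMeasure Δ.dx y - φ 0 := fun y => by
    have := (gridMeasure_mem hh y).1
    have hi : Integrable φ (gridMeasure Δ.dx y) := by
      refine ((hint y).add (integrable_const (φ 0))).congr (Eventually.of_forall fun x => ?_)
      simp
    rw [integral_sub hi (integrable_const _)]
    simp
  have hcell : ∀ i : Idx d, |1 / Δ.dx ^ d * ∫ x in cell Δ.dx i, (φ x - φ 0)|
      ≤ d * Δ.dx * (1 + ‖i‖) := fun i => by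
    have hv : volume.real (cell Δ.dx i) = Δ.dx ^ d := by
      rw [Measure.real, volume_cell hh, ENNReal.toReal_ofReal (by positivity)]
    have := norm_setIntegral_le_of_norm_le_const (μ := volume) (s := cell Δ.dx i)
      (f := fun x => φ x - φ 0) (C := d * Δ.dx * ‖i‖ + d * Δ.dx)
      (by rw [volume_cell hh]; exact ENNReal.ofReal_lt_top)
      (fun x hx => (hψ x).trans (norm_le_of_mem_cell hh hx))
    rw [hv, Real.norm_eq_abs] at this
    rw [abs_mul, abs_of_nonneg (by positivity), one_div, inv_mul_le_iff₀ (by positivity)]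
    linarith
  have hs := (hasSum_integral_gridMeasure hh z (hint z)).sub
    (hasSum_integral_gridMeasure hh z' (hint z'))
  rw [hsub, hsub, sub_sub_sub_cancel_right] at hs
  change ∫ x, φ x ∂gridMeasure Δ.dx z - ∫ x, φ x ∂gridMeasure Δ.dx z' ≤ _
  refine hasSum_le (fun i => ?_) hs ((summable_wdist z z').hasSum.mul_left (d * Δ.dx))
  rw [← sub_mul]
  refine (le_abs_self _).trans ?_
  rw [abs_mul]
  calc _ ≤ |z i - z' i| * (d * Δ.dx * (1 + ‖i‖)) :=
        mul_le_mul_of_nonneg_left (hcell i) (abs_nonneg _)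
    _ = _ := by ring

/-! ### Couplings on the grid -/

/-- A coupling on the grid which is bounded, Lipschitz in the distribution, and monotone. -/
structure IsMonotoneCoupling (c : Idx d → GridProb d → ℝ) : Prop where
  bdd : ∃ C, 0 ≤ C ∧ ∀ i z, |c i z| ≤ C
  lip : ∃ K, 0 ≤ K ∧ ∀ i z z', |c i z - c i z'| ≤ K * wdist z z'
  mono : ∀ z z' : GridProb d, 0 ≤ ∑' i, (c i z - c i z') * (z i - z' i)

theorem summable_mul_of_bdd {c z : Idx d → ℝ} {C : ℝ} (hc : ∀ i, |c i| ≤ C) (hz : Summable z) :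
    Summable fun i => c i * z i :=
  Summable.of_norm_bounded (hz.abs.mul_left C) fun i => by
    rw [Real.norm_eq_abs, abs_mul]
    exact mul_le_mul_of_nonneg_right (hc i) (abs_nonneg _)

/-- The restriction of `z` to a box, the remaining mass being put at the origin. -/
def GridProb.truncate (z : GridProb d) (b : ℤ) : GridProb d where
  toFun i := (if i ∈ box d b then z i else 0)
    + if i = 0 then 1 - ∑ j ∈ box d b, z j else 0
  nonneg i := by
    have : ∑ j ∈ box d b, z j ≤ 1 := by
      rw [← z.hasSum.tsum_eq]
      exact z.hasSum.summable.sum_le_tsum _ fun i _ => z.nonneg i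
    have := z.nonneg i
    split_ifs <;> linarith
  hasSum := by
    have h1 : HasSum (fun i => if i ∈ box d b then z i else 0) (∑ j ∈ box d b, z j) := by
      have : HasSum (fun i => if i ∈ box d b then z i else 0)
          (∑ i ∈ box d b, if i ∈ box d b then z i else 0) :=
        hasSum_sum_of_ne_finset_zero fun i hi => by simp [hi]
      rwa [Finset.sum_congr rfl fun i hi => if_pos hi] at this
    simpa using h1.add (hasSum_ite_eq (0 : Idx d) (1 - ∑ j ∈ box d b, z j))
  moment := by
    refine summable_of_ne_finset_zero (s := insert 0 (box d b)) fun i hi => ?_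
    simp only [Finset.mem_insert, not_or] at hi
    simp [hi.1, hi.2]

theorem GridProb.finite_support_truncate (z : GridProb d) (b : ℤ) :
    (Function.support (z.truncate b)).Finite := by
  refine (insert 0 (box d b)).finite_toSet.subset fun i hi => ?_
  by_contra hcon
  simp only [Finset.coe_insert, Set.mem_insert_iff, Finset.mem_coe, not_or] at hcon
  exact hi (by simp [GridProb.truncate, hcon.1, hcon.2])

theorem tendsto_box : Tendsto (fun n : ℕ => box d n) atTop atTop := by
  refine tendsto_atTop_finset_of_monotone (fun m n hmn i => ?_) fun i => ?_
  · simp only [mem_box]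
    exact fun h l => (h l).trans (by exact_mod_cast hmn)
  · refine ⟨∑ l, (i l).natAbs, mem_box.2 fun l => ?_⟩
    rw [Int.abs_eq_natAbs]
    exact_mod_cast Finset.single_le_sum (f := fun l => (i l).natAbs) (fun _ _ => Nat.zero_le _)
      (Finset.mem_univ l)

theorem GridProb.tendsto_truncate (z : GridProb d) (i : Idx d) :
    Tendsto (fun n : ℕ => z.truncate n i) atTop (𝓝 (z i)) := by
  have h1 : Tendsto (fun n : ℕ => if i ∈ box d n then z i else 0) atTop (𝓝 (z i)) := by
    refine tendsto_const_nhds.congr' ?_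
    filter_upwards [tendsto_box.eventually (eventually_ge_atTop {i})] with n hn
    rw [if_pos (Finset.singleton_subset_iff.1 hn)]
  have h2 : Tendsto (fun n : ℕ => if i = 0 then 1 - ∑ j ∈ box d n, z j else 0) atTop (𝓝 0) := by
    split_ifs
    · simpa using (z.hasSum.comp tendsto_box).const_sub 1
    · exact tendsto_const_nhds
  simpa [GridProb.truncate] using h1.add h2

theorem GridProb.abs_truncate_sub_le (z : GridProb d) (b : ℤ) (i : Idx d) :
    |z.truncate b i - z i| ≤ z i + if i = 0 then 1 else 0 := by
  have h1 : ∑ j ∈ box d b, z j ≤ 1 := by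
    rw [← z.hasSum.tsum_eq]
    exact z.hasSum.summable.sum_le_tsum _ fun i _ => z.nonneg i
  have h2 : 0 ≤ ∑ j ∈ box d b, z j := Finset.sum_nonneg fun i _ => z.nonneg i
  have := z.nonneg i
  rw [abs_le]
  simp only [GridProb.truncate]
  split_ifs <;> constructor <;> linarith

theorem summable_weight_ite_zero :
    Summable fun i : Idx d => (1 + ‖i‖) * if i = 0 then (1 : ℝ) else 0 :=
  summable_of_ne_finset_zero (s := {0}) fun i hi => by
    simp [Finset.mem_singleton.not.1 hi]

theorem GridProb.tendsto_wdist_truncate (z : GridProb d) :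
    Tendsto (fun n : ℕ => wdist (z.truncate n) z) atTop (𝓝 0) := by
  refine tendsto_wdist_of_dominated (b := fun i => z i + if i = 0 then 1 else 0) ?_
    (Eventually.of_forall fun n => z.abs_truncate_sub_le n) z.tendsto_truncate
  simp only [mul_add]
  exact z.summable_weight.add summable_weight_ite_zero

/-- Monotonicity is assumed only for finite supports, but the initial guess, and with it every
average, may have infinite support. Truncations converge in `wdist`, and boundedness of the coupling
provides the majorant for passing to the limit in the series. -/
theorem monotone_of_finite_support {c : Idx d → GridProb d → ℝ} {C K : ℝ} (hC : 0 ≤ C)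
    (hbdd : ∀ i z, |c i z| ≤ C) (hlip : ∀ i z z', |c i z - c i z'| ≤ K * wdist z z')
    (hmono : ∀ z z' : GridProb d, (Function.support z).Finite → (Function.support z').Finite →
      0 ≤ ∑' i, (c i z - c i z') * (z i - z' i)) (z z' : GridProb d) :
    0 ≤ ∑' i, (c i z - c i z') * (z i - z' i) := by
  have hc : ∀ (y : GridProb d) i, Tendsto (fun n : ℕ => c i (y.truncate n)) atTop (𝓝 (c i y)) := by
    intro y i
    rw [tendsto_iff_dist_tendsto_zero]
    refine squeeze_zero (fun _ => dist_nonneg) (fun n => hlip i _ _) ?_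
    simpa using y.tendsto_wdist_truncate.const_mul K
  have hbound : ∀ (y : GridProb d) (n : ℕ) i,
      y.truncate n i ≤ 2 * y i + if i = 0 then 1 else 0 := by
    intro y n i
    have := (abs_le.1 (y.abs_truncate_sub_le n i)).2
    linarith
  have hsum : ∀ y : GridProb d, Summable fun i => 2 * y i + if i = 0 then (1 : ℝ) else 0 :=
    fun y => (y.hasSum.summable.mul_left 2).add (hasSum_ite_eq (0 : Idx d) (1 : ℝ)).summable
  have := tendsto_tsum_of_dominated_convergence (𝓕 := atTop)
    (f := fun (n : ℕ) i => (c i (z.truncate n) - c i (z'.truncate n))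
      * (z.truncate n i - z'.truncate n i))
    (g := fun i => (c i z - c i z') * (z i - z' i))
    (((hsum z).add (hsum z')).mul_left (2 * C)) ?_ ?_
  · exact ge_of_tendsto' this fun n => hmono _ _ (z.finite_support_truncate n)
      (z'.finite_support_truncate n)
  · exact fun i => ((hc z i).sub (hc z' i)).mul ((z.tendsto_truncate i).sub (z'.tendsto_truncate i))
  · refine Eventually.of_forall fun n i => ?_
    rw [norm_mul]
    refine mul_le_mul ?_ ?_ (norm_nonneg _) (by positivity)
    · have h1 := norm_sub_le (c i (z.truncate n)) (c i (z'.truncate n))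
      have h2 := hbdd i (z.truncate n)
      have h3 := hbdd i (z'.truncate n)
      simp only [Real.norm_eq_abs] at h1 ⊢
      linarith
    · have h1 := norm_sub_le (z.truncate n i) (z'.truncate n i)
      rw [Real.norm_of_nonneg ((z.truncate n).nonneg i),
        Real.norm_of_nonneg ((z'.truncate n).nonneg i)] at h1
      linarith [hbound z n i, hbound z' n i]

theorem isMonotoneCoupling_onGrid (Δ : Mesh T) {F : E d → P1 d → ℝ} {C : ℝ} (hC : 0 ≤ C)
    (hbdd : ∀ x μ, |F x μ| ≤ C) (hlip : LipschitzInMeasure F) (hmono : DiscreteMonotone Δ F) :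
    IsMonotoneCoupling (onGrid Δ F) := by
  obtain ⟨K, hK, hl⟩ := hlip
  have hlip' : ∀ i z z', |onGrid Δ F i z - onGrid Δ F i z'| ≤ K * (d * Δ.dx) * wdist z z' :=
    fun i z z' => (hl _ _ _).trans (by
      rw [mul_assoc]; exact mul_le_mul_of_nonneg_left (d1_toP1_le Δ z z') hK.le)
  have hdx := Δ.dx_pos
  exact ⟨⟨C, hC, fun i z => hbdd _ _⟩, ⟨_, by positivity, hlip'⟩,
    monotone_of_finite_support hC (fun i z => hbdd _ _) hlip' hmono⟩

theorem IsMonotoneCoupling.const_mul {c : Idx d → GridProb d → ℝ} (hc : IsMonotoneCoupling c)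
    {t : ℝ} (ht : 0 ≤ t) : IsMonotoneCoupling fun i z => t * c i z := by
  obtain ⟨C, hC, hb⟩ := hc.bdd
  obtain ⟨K, hK, hl⟩ := hc.lip
  refine ⟨⟨t * C, by positivity, fun i z => ?_⟩, ⟨t * K, by positivity, fun i z z' => ?_⟩,
    fun z z' => ?_⟩
  · rw [abs_mul, abs_of_nonneg ht]
    exact mul_le_mul_of_nonneg_left (hb i z) ht
  · rw [← mul_sub, abs_mul, abs_of_nonneg ht, mul_assoc]
    exact mul_le_mul_of_nonneg_left (hl i z z') ht
  · simp only [← mul_sub, mul_assoc, tsum_mul_left]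
    exact mul_nonneg ht (hc.mono z z')

/-! ### The initial distribution -/

/-- The index of the half-open cell which contains `x`. -/
def cellIndex (h : ℝ) (x : E d) : Idx d := fun l => ⌊x l / h + 1 / 2⌋

theorem measurable_cellIndex (h : ℝ) : Measurable (cellIndex h : E d → Idx d) := by
  refine measurable_pi_iff.2 fun l => Int.measurable_floor.comp ?_
  fun_prop

theorem cell_ae_eq {h : ℝ} (hh : 0 < h) (i : Idx d) :
    cell h i =ᵐ[volume] cellIndex h ⁻¹' {i} := by
  have h1 : cellIndex h ⁻¹' {i} = (WithLp.ofLp : E d → Fin d → ℝ) ⁻¹'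
      (Set.univ.pi fun l => Set.Ico ((i l : ℝ) * h - h / 2) ((i l : ℝ) * h + h / 2)) := by
    ext x
    simp only [Set.mem_preimage, Set.mem_singleton_iff, cellIndex, funext_iff, Int.floor_eq_iff,
      Set.mem_univ_pi, Set.mem_Ico]
    refine forall_congr' fun l => ?_
    have e1 : x l / h + 1 / 2 = (x l + h / 2) / h := by field_simp
    rw [e1, le_div_iff₀ hh, div_lt_iff₀ hh]
    constructor <;> rintro ⟨a, b⟩ <;> constructor <;> linarith
  rw [cell_eq, h1]
  exact (PiLp.volume_preserving_ofLp (Fin d)).quasiMeasurePreserving.preimage_ae_eq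
    Measure.univ_pi_Ico_ae_eq_Icc.symm

/-- The closed cells overlap along their faces. Absolute continuity allows them to be replaced by
half-open cells, the fibres of `cellIndex`, which partition the space. -/
theorem hasSum_measure_cell {h : ℝ} (hh : 0 < h) {μ : Measure (E d)} [IsProbabilityMeasure μ]
    (hμ : μ ≪ volume) : HasSum (fun i => μ.real (cell h i)) 1 := by
  have h1 : ∀ i, μ (cell h i) = μ (cellIndex h ⁻¹' {i}) := fun i =>
    measure_congr (hμ.ae_le (cell_ae_eq hh i))
  have h2 : ∑' i : Idx d, μ (cell h i) = 1 := by
    simp only [h1]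
    rw [← measure_iUnion (fun i j hij => Disjoint.preimage _ (by simpa using hij))
      fun i => measurable_cellIndex h (measurableSet_singleton i)]
    rw [← Set.preimage_iUnion, Set.iUnion_of_singleton, Set.preimage_univ, measure_univ]
  have h3 := ENNReal.summable_toReal (h2.trans_ne ENNReal.one_ne_top)
  have h4 := h3.hasSum
  rw [← ENNReal.tsum_toReal_eq fun i => measure_ne_top μ _, h2] at h4
  simpa [Measure.real] using h4

theorem exists_initial (Δ : Mesh T) {m₀ : P1 d} (hinit : RegularInitial m₀) :
    ∃ (z : GridProb d) (b : ℤ), (∀ i, z i = m₀.1.real (cell Δ.dx i)) ∧ ∀ i ∉ box d b, z i = 0 := by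
  obtain ⟨ρ, hρ, -, hm, C, hC, hsupp⟩ := hinit
  have hprob := m₀.2.1
  have hdx := Δ.dx_pos
  have hac : m₀.1 ≪ volume := by rw [hm]; exact withDensity_absolutelyContinuous _ _
  -- If `|i l| * Δx > C + Δx`, every point of the cell has a coordinate larger than `C + Δx / 2` in
  -- absolute value, hence lies outside the support of the density.
  have hzero : ∀ i ∉ box d ⌈C / Δ.dx + 1⌉, m₀.1.real (cell Δ.dx i) = 0 := by
    intro i hi
    rw [Measure.real, hm, withDensity_apply _ (measurableSet_cell _ _),
      setLIntegral_congr_fun (g := fun _ => 0) (measurableSet_cell _ _) fun x hx => ?_]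
    · simp
    · have : x ∉ tsupport ρ := fun hx' => by
        rw [mem_box, not_forall] at hi
        obtain ⟨l, hl⟩ := hi
        have h1 : ‖x‖ ≤ C := by simpa using hsupp hx'
        have h2 : |x l| ≤ C := (PiLp.norm_apply_le x l).trans h1
        have h3 := hx l
        rw [pt_apply] at h3
        have h4 : C / Δ.dx + 1 < |(i l : ℝ)| := 
          (Int.le_ceil _).trans_lt (by exact_mod_cast not_le.1 hl)
        have h5 := mul_lt_mul_of_pos_right h4 hdx
        rw [add_mul, div_mul_cancel₀ _ hdx.ne'] at h5
        have h6 : |(i l : ℝ)| * Δ.dx = |i l * Δ.dx| := by rw [abs_mul, abs_of_pos hdx]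
        have h7 := abs_sub_abs_le_abs_sub (i l * Δ.dx) (x l)
        rw [abs_sub_comm] at h7
        linarith
      simp [image_eq_zero_of_notMem_tsupport this]
  refine ⟨⟨fun i => m₀.1.real (cell Δ.dx i), fun i => measureReal_nonneg,
    hasSum_measure_cell hdx hac, ?_⟩, _, fun i => rfl, hzero⟩
  exact summable_of_ne_finset_zero (s := box d ⌈C / Δ.dx + 1⌉) fun i hi => by
    rw [hzero i hi, mul_zero]

end

section

variable {d : ℕ} {T : ℝ}

/-! ### The minimal cost of one step -/

/-- The minimal value of the discrete cost `stepCost` over the admissible controls. -/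
def minCost (Δ : Mesh T) (L : E d → E d → ℝ) (R : ℝ) (W : Idx d → ℝ) (i : Idx d) : ℝ :=
  sInf (stepCost Δ L W i '' controls d R)

/-- The coupling at time `k`, with the weights of the dynamic programming equation. -/
def coupling (Δ : Mesh T) (F G : E d → P1 d → ℝ) (k : Fin (Δ.N + 1)) (i : Idx d)
    (z : GridProb d) : ℝ :=
  if k = Fin.last Δ.N then onGrid Δ G i z else Δ.dt * onGrid Δ F i z

theorem coupling_last (Δ : Mesh T) (F G : E d → P1 d → ℝ) (i : Idx d) (z : GridProb d) :
    coupling Δ F G (Fin.last Δ.N) i z = onGrid Δ G i z := if_pos rfl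

theorem coupling_castSucc (Δ : Mesh T) (F G : E d → P1 d → ℝ) (k : Fin Δ.N) (i : Idx d)
    (z : GridProb d) : coupling Δ F G k.castSucc i z = Δ.dt * onGrid Δ F i z :=
  if_neg (Fin.castSucc_lt_last k).ne

/-- The properties of the data from which the convergence of the iteration is derived. -/
structure IsRegularSystem (Δ : Mesh T) (L : E d → E d → ℝ) (F G : E d → P1 d → ℝ) (R : ℝ) :
    Prop where
  pos : 0 < R
  lagrangian : LagrangianAssumptions L
  coupling : ∀ k, IsMonotoneCoupling (coupling Δ F G k)
  unique : UniqueControls Δ L F G R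

variable {Δ : Mesh T} {L : E d → E d → ℝ} {F G : E d → P1 d → ℝ} {R : ℝ}

theorem minCost_le (hL : LagrangianAssumptions L) (W : Idx d → ℝ) (i : Idx d) {a : E d} (ha : a ∈ controls d R) : minCost Δ L R W i ≤ stepCost Δ L W i a :=
  csInf_le ((isCompact_controls d R).bddBelow_image (continuousOn_stepCost Δ hL.1 R W i))
    (Set.mem_image_of_mem _ ha)

theorem exists_stepCost_eq_minCost (hL : LagrangianAssumptions L) (W : Idx d → ℝ) (i : Idx d)
    (hR : 0 < R) :
    ∃ a ∈ controls d R, stepCost Δ L W i a = minCost Δ L R W i := by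
  obtain ⟨a, ha, hmin⟩ := (isCompact_controls d R).exists_isMinOn ⟨0, zero_mem_controls hR⟩
    (continuousOn_stepCost Δ hL.1 R W i)
  refine ⟨a, ha, (IsLeast.csInf_eq ⟨Set.mem_image_of_mem _ ha, ?_⟩).symm⟩
  rintro _ ⟨b, hb, rfl⟩
  exact hmin hb

theorem abs_stepCost_sub_le {W W' : Idx d → ℝ} {ε : ℝ} (hW : ∀ i, |W i - W' i| ≤ ε) (i : Idx d)
    (a : E d) :
    |stepCost Δ L W i a - stepCost Δ L W' i a| ≤ ε := by
  simp only [stepCost, add_sub_add_right_eq_sub]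
  exact abs_interp_sub_le Δ.dx_pos hW _

theorem abs_minCost_sub_le (hL : LagrangianAssumptions L) (hR : 0 < R) {W W' : Idx d → ℝ} {ε : ℝ}
    (hW : ∀ i, |W i - W' i| ≤ ε) (i : Idx d) :
    |minCost Δ L R W i - minCost Δ L R W' i| ≤ ε := by
  obtain ⟨a, ha, hae⟩ := exists_stepCost_eq_minCost (Δ := Δ) hL W i hR
  obtain ⟨b, hb, hbe⟩ := exists_stepCost_eq_minCost (Δ := Δ) hL W' i hR
  have h1 := abs_le.1 (abs_stepCost_sub_le (Δ := Δ) (L := L) hW i a)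
  have h2 := abs_le.1 (abs_stepCost_sub_le (Δ := Δ) (L := L) hW i b)
  have h3 := minCost_le (Δ := Δ) hL W i hb
  have h4 := minCost_le (Δ := Δ) hL W' i ha
  rw [abs_le]
  constructor <;> linarith

theorem stepCost_sub_minCost_le (hL : LagrangianAssumptions L) (hR : 0 < R) {W W' : Idx d → ℝ}
    {ε : ℝ} (hW : ∀ i, |W i - W' i| ≤ ε) (i : Idx d) (a : E d) :
    stepCost Δ L W i a - minCost Δ L R W i
      ≤ stepCost Δ L W' i a - minCost Δ L R W' i + 2 * ε := by
  have h1 := abs_le.1 (abs_stepCost_sub_le (Δ := Δ) (L := L) hW i a)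
  have h2 := abs_le.1 (abs_minCost_sub_le (Δ := Δ) hL hR hW i)
  linarith

theorem exists_abs_minCost_le (hL : LagrangianAssumptions L) (hR : 0 < R) :
    ∃ K, ∀ (W : Idx d → ℝ) (C : ℝ), (∀ i, |W i| ≤ C) → ∀ i, |minCost Δ L R W i| ≤ C + K := by
  obtain ⟨B, hB⟩ := (isCompact_controls d R).isBounded.exists_norm_le
  obtain ⟨c, hc⟩ := hL.2.1
  obtain ⟨C₁, hC₁, C₂, _, _, _, _, _, _, _, hb⟩ := hL.2.2
  refine ⟨Δ.dt * max (-c) (C₁ * B ^ 2 + C₂), fun W C hW i => ?_⟩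
  obtain ⟨a, ha, hae⟩ := exists_stepCost_eq_minCost (Δ := Δ) hL W i hR
  rw [← hae, stepCost]
  refine (abs_add_le _ _).trans (add_le_add (abs_interp_le Δ.dx_pos hW _) ?_)
  rw [abs_mul, abs_of_pos Δ.dt_pos]
  refine mul_le_mul_of_nonneg_left ?_ Δ.dt_pos.le
  have h1 : ‖a‖ ^ 2 ≤ B ^ 2 := pow_le_pow_left₀ (norm_nonneg _) (hB a ha) 2
  have h2 := mul_le_mul_of_nonneg_left h1 hC₁.le
  rw [abs_le]
  constructor
  · linarith [hc (pt Δ.dx i) a, le_max_left (-c) (C₁ * B ^ 2 + C₂)]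
  · linarith [(hb (pt Δ.dx i) a).1, le_max_right (-c) (C₁ * B ^ 2 + C₂)]

theorem stepCost_eq_minCost {v : Fin (Δ.N + 1) → Idx d → ℝ} {k : Fin Δ.N} {i : Idx d} {a : E d}
    (ha : a ∈ optControls Δ L R v k i) :
    stepCost Δ L (v k.succ) i a = minCost Δ L R (v k.succ) i := by
  refine (IsLeast.csInf_eq ⟨Set.mem_image_of_mem _ ha.1, ?_⟩).symm
  rintro _ ⟨b, hb, rfl⟩
  exact ha.2 hb

theorem mem_optControls_of_stepCost_eq (hL : LagrangianAssumptions L)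
    {v : Fin (Δ.N + 1) → Idx d → ℝ} {k : Fin Δ.N} {i : Idx d} {a : E d} (ha : a ∈ controls d R)
    (h : stepCost Δ L (v k.succ) i a = minCost Δ L R (v k.succ) i) :
    a ∈ optControls Δ L R v k i :=
  ⟨ha, fun b hb => by
    change stepCost Δ L (v k.succ) i a ≤ stepCost Δ L (v k.succ) i b
    rw [h]; exact minCost_le hL _ i hb⟩

/-! ### The discrete Hamilton-Jacobi-Bellman equation -/

theorem SolvesHJB.eq_castSucc {ν : Fin (Δ.N + 1) → GridProb d} {v : Fin (Δ.N + 1) → Idx d → ℝ}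
    (hv : SolvesHJB Δ L F G R ν v) (k : Fin Δ.N) (i : Idx d) :
    v k.castSucc i = minCost Δ L R (v k.succ) i + coupling Δ F G k.castSucc i (ν k.castSucc) := by
  rw [coupling_castSucc]; exact hv.2.1 k i

theorem SolvesHJB.eq_last {ν : Fin (Δ.N + 1) → GridProb d} {v : Fin (Δ.N + 1) → Idx d → ℝ}
    (hv : SolvesHJB Δ L F G R ν v) (i : Idx d) :
    v (Fin.last _) i = coupling Δ F G (Fin.last _) i (ν (Fin.last _)) := by
  rw [coupling_last]; exact hv.2.2 i

theorem exists_solvesHJB (hS : IsRegularSystem Δ L F G R) (ν : Fin (Δ.N + 1) → GridProb d) :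
    ∃ v, SolvesHJB Δ L F G R ν v := by
  let v : Fin (Δ.N + 1) → Idx d → ℝ := Fin.reverseInduction (motive := fun _ => Idx d → ℝ)
    (fun i => coupling Δ F G (Fin.last _) i (ν (Fin.last _)))
    (fun k W i => minCost Δ L R W i + coupling Δ F G k.castSucc i (ν k.castSucc))
  have hlast : ∀ i, v (Fin.last _) i = coupling Δ F G (Fin.last _) i (ν (Fin.last _)) := by
    intro i; simp [v]
  have hcast : ∀ (k : Fin Δ.N) i, v k.castSucc i
      = minCost Δ L R (v k.succ) i + coupling Δ F G k.castSucc i (ν k.castSucc) := by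
    intro k i; simp [v]
  have hbdd : ∀ k, ∃ C, ∀ i, |v k i| ≤ C := by
    intro k
    induction k using Fin.reverseInduction with
    | last =>
      obtain ⟨C, -, hC⟩ := (hS.coupling (Fin.last _)).bdd
      exact ⟨C, fun i => by rw [hlast]; exact hC _ _⟩
    | cast k ih =>
      obtain ⟨C, -, hC⟩ := (hS.coupling k.castSucc).bdd
      obtain ⟨B, hB⟩ := ih
      obtain ⟨K, hK⟩ := exists_abs_minCost_le (Δ := Δ) hS.lagrangian hS.pos
      refine ⟨B + K + C, fun i => ?_⟩
      rw [hcast]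
      exact (abs_add_le _ _).trans (add_le_add (hK _ _ hB i) (hC _ _))
  refine ⟨v, ?_, fun k i => ?_, fun i => ?_⟩
  · choose C hC using hbdd
    obtain ⟨M, hM⟩ := Finite.exists_le C
    exact ⟨M, fun k i => (hC k i).trans (hM k)⟩
  · rw [hcast, coupling_castSucc]; rfl
  · rw [hlast, coupling_last]

/-- The distance of flows of grid distributions. -/
def flowDist {n : ℕ} (ν ν' : Fin n → GridProb d) : ℝ := ∑ k, wdist (ν k) (ν' k)

theorem flowDist_nonneg {n : ℕ} (ν ν' : Fin n → GridProb d) : 0 ≤ flowDist ν ν' :=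
  Finset.sum_nonneg fun _ _ => wdist_nonneg _ _

theorem flowDist_triangle {n : ℕ} (ν ν' ν'' : Fin n → GridProb d) :
    flowDist ν ν'' ≤ flowDist ν ν' + flowDist ν' ν'' := by
  unfold flowDist
  rw [← Finset.sum_add_distrib]
  exact Finset.sum_le_sum fun _ _ => wdist_triangle _ _ _

theorem wdist_le_flowDist {n : ℕ} (ν ν' : Fin n → GridProb d) (k : Fin n) :
    wdist (ν k) (ν' k) ≤ flowDist ν ν' :=
  Finset.single_le_sum (f := fun k => wdist (ν k) (ν' k)) (fun _ _ => wdist_nonneg _ _)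
    (Finset.mem_univ k)

theorem flowDist_self {n : ℕ} (ν : Fin n → GridProb d) : flowDist ν ν = 0 := by
  simp [flowDist, wdist]

theorem exists_coupling_lipschitz (hS : IsRegularSystem Δ L F G R) :
    ∃ K, 0 ≤ K ∧ ∀ (ν ν' : Fin (Δ.N + 1) → GridProb d) k i,
      |coupling Δ F G k i (ν k) - coupling Δ F G k i (ν' k)| ≤ K * flowDist ν ν' := by
  choose K hK hl using fun k => (hS.coupling k).lip
  obtain ⟨M, hM⟩ := Finite.exists_le K
  refine ⟨M, (hK 0).trans (hM 0), fun ν ν' k i => (hl k i _ _).trans ?_⟩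
  exact mul_le_mul (hM k) (wdist_le_flowDist ν ν' k) (wdist_nonneg _ _) ((hK 0).trans (hM 0))

/-- Backward induction: the minimal cost is nonexpansive in the next value function, so each time
step only adds the Lipschitz constant of the coupling. Equal flows give uniqueness of the value
function. -/
theorem exists_solvesHJB_lipschitz (hS : IsRegularSystem Δ L F G R) :
    ∃ K, 0 ≤ K ∧ ∀ ν ν' v v', SolvesHJB Δ L F G R ν v → SolvesHJB Δ L F G R ν' v' →
      ∀ k i, |v k i - v' k i| ≤ K * flowDist ν ν' := by
  obtain ⟨c, hc, hlip⟩ := exists_coupling_lipschitz hS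
  have key : ∀ k : Fin (Δ.N + 1), ∃ K, 0 ≤ K ∧ ∀ ν ν' v v', SolvesHJB Δ L F G R ν v →
      SolvesHJB Δ L F G R ν' v' → ∀ i, |v k i - v' k i| ≤ K * flowDist ν ν' := by
    intro k
    induction k using Fin.reverseInduction with
    | last =>
      refine ⟨c, hc, fun ν ν' v v' hv hv' i => ?_⟩
      rw [hv.eq_last, hv'.eq_last]
      exact hlip _ _ _ _
    | cast k ih =>
      obtain ⟨K, hK, ih⟩ := ih
      refine ⟨K + c, by positivity, fun ν ν' v v' hv hv' i => ?_⟩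
      rw [hv.eq_castSucc, hv'.eq_castSucc, add_sub_add_comm, add_mul]
      exact (abs_add_le _ _).trans (add_le_add
        (abs_minCost_sub_le hS.lagrangian hS.pos (ih ν ν' v v' hv hv') i) (hlip _ _ _ _))
  choose K hK hl using key
  obtain ⟨M, hM⟩ := Finite.exists_le K
  exact ⟨M, (hK 0).trans (hM 0), fun ν ν' v v' hv hv' k i => (hl k ν ν' v v' hv hv' i).trans
    (mul_le_mul_of_nonneg_right (hM k) (flowDist_nonneg _ _))⟩

theorem SolvesHJB.unique (hS : IsRegularSystem Δ L F G R) {ν : Fin (Δ.N + 1) → GridProb d}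
    {v v' : Fin (Δ.N + 1) → Idx d → ℝ} (hv : SolvesHJB Δ L F G R ν v)
    (hv' : SolvesHJB Δ L F G R ν v') : v = v' := by
  obtain ⟨K, -, hl⟩ := exists_solvesHJB_lipschitz hS
  funext k i
  have := hl ν ν v v' hv hv' k i
  rw [flowDist_self, mul_zero] at this
  exact sub_eq_zero.1 (abs_nonpos_iff.1 this)

theorem exists_optFeedback (hS : IsRegularSystem Δ L F G R) {ν : Fin (Δ.N + 1) → GridProb d}
    {v : Fin (Δ.N + 1) → Idx d → ℝ} (hv : SolvesHJB Δ L F G R ν v) :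
    ∃ q, q ∈ optFeedbacks Δ L R v := by
  choose q hq using fun k i => (hS.unique ν v hv k i).exists
  exact ⟨q, hq⟩

theorem optFeedbacks_eq_singleton (hS : IsRegularSystem Δ L F G R)
    {ν : Fin (Δ.N + 1) → GridProb d} {v : Fin (Δ.N + 1) → Idx d → ℝ}
    (hv : SolvesHJB Δ L F G R ν v) {q : Fin Δ.N → Idx d → E d} (hq : q ∈ optFeedbacks Δ L R v) :
    optFeedbacks Δ L R v = {q} :=
  Set.eq_singleton_iff_unique_mem.2
    ⟨hq, fun _ hq' => funext fun k => funext fun i => (hS.unique ν v hv k i).unique (hq' k i) (hq k i)⟩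

/-- Quantitative form of the uniqueness of optimal controls: a continuous quantity that is
nonpositive at the optimal control is controlled by the excess cost. -/
theorem exists_le_add_mul_stepCost (hS : IsRegularSystem Δ L F G R)
    {ν : Fin (Δ.N + 1) → GridProb d} {v : Fin (Δ.N + 1) → Idx d → ℝ}
    (hv : SolvesHJB Δ L F G R ν v) {q : Fin Δ.N → Idx d → E d} (hq : q ∈ optFeedbacks Δ L R v)
    (k : Fin Δ.N) (i : Idx d) {D : E d → ℝ} (hD : Continuous D) (h0 : D (q k i) ≤ 0) {η : ℝ}
    (hη : 0 < η) : ∃ C, 0 ≤ C ∧ ∀ a ∈ controls d R,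
      D a ≤ η + C * (stepCost Δ L (v k.succ) i a - minCost Δ L R (v k.succ) i) := by
  refine exists_le_add_mul_of_min (isCompact_controls d R)
    (continuousOn_stepCost Δ hS.lagrangian.1 R _ i) hD.continuousOn
    (fun a ha => minCost_le hS.lagrangian _ i ha) (fun a ha hae => ?_) hη
  rwa [(hS.unique ν v hv k i).unique
    (mem_optControls_of_stepCost_eq hS.lagrangian ha hae) (hq k i)]

end

section

variable {d : ℕ} {T : ℝ} {Δ : Mesh T} {L : E d → E d → ℝ} {F G : E d → P1 d → ℝ} {R : ℝ}
  {m₀ : P1 d} {b : ℤ}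

/-! ### The discrete transport equation -/

/-- A box containing the support, at time `k`, of transports of a distribution which is supported
in the box of size `b`. -/
def reachBox (Δ : Mesh T) (d : ℕ) (R : ℝ) (b : ℤ) (k : ℕ) : Finset (Idx d) :=
  box d (b + k * reach Δ R)

theorem hat_eq_zero_of_notMem_reachBox {k : ℕ} {i j : Idx d} (hj : j ∈ reachBox Δ d R b k)
    (hi : i ∉ reachBox Δ d R b (k + 1)) {a : E d} (ha : a ∈ controls d R) :
    hat Δ.dx i (pt Δ.dx j - Δ.dt • a) = 0 := by
  refine hat_eq_zero_of_notMem_nearby Δ ha fun h => hi ?_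
  have := nearby_subset_box hj h
  rwa [reachBox, show b + ((k + 1 : ℕ) : ℤ) * reach Δ R = b + k * reach Δ R + reach Δ R by
    push_cast; ring]

/-- Mass is conserved because the hats sum to 1 at each point reached. The support stays finite, so
the sums may be exchanged and the first moment is automatic. -/
theorem exists_transportStep {z : GridProb d} {k : ℕ} (hz : ∀ i ∉ reachBox Δ d R b k, z i = 0)
    {q : Idx d → E d} (hq : ∀ i, q i ∈ controls d R) :
    ∃ z' : GridProb d, ∀ i, z' i = ∑' j, hat Δ.dx i (pt Δ.dx j - Δ.dt • q j) * z j := by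
  have hfin : ∀ i, ∑' j, hat Δ.dx i (pt Δ.dx j - Δ.dt • q j) * z j
      = ∑ j ∈ reachBox Δ d R b k, hat Δ.dx i (pt Δ.dx j - Δ.dt • q j) * z j :=
    fun i => tsum_eq_sum fun j hj => by rw [hz j hj, mul_zero]
  have hzero : ∀ i ∉ reachBox Δ d R b (k + 1),
      ∑' j, hat Δ.dx i (pt Δ.dx j - Δ.dt • q j) * z j = 0 := fun i hi => by
    rw [hfin]
    exact Finset.sum_eq_zero fun j hj => by
      rw [hat_eq_zero_of_notMem_reachBox hj hi (hq j), zero_mul]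
  refine ⟨⟨fun i => ∑' j, hat Δ.dx i (pt Δ.dx j - Δ.dt • q j) * z j,
    fun i => tsum_nonneg fun j => mul_nonneg (hat_nonneg _ _ _) (z.nonneg j), ?_, ?_⟩, fun i => rfl⟩
  · have hsum : ∑ i ∈ reachBox Δ d R b (k + 1),
        ∑' j, hat Δ.dx i (pt Δ.dx j - Δ.dt • q j) * z j = 1 := by
      simp only [hfin]
      rw [Finset.sum_comm, ← z.hasSum.tsum_eq, tsum_eq_sum hz]
      refine Finset.sum_congr rfl fun j hj => ?_
      rw [← Finset.sum_mul, sum_hat_eq_one Δ.dx_pos fun i hi =>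
        hat_eq_zero_of_notMem_reachBox hj hi (hq j), one_mul]
    rw [← hsum]
    exact hasSum_sum_of_ne_finset_zero hzero
  · exact summable_of_ne_finset_zero fun i hi => by rw [hzero i hi, mul_zero]

/-- The initial distribution of the grid vanishes outside of a box. -/
def InitialSupport (Δ : Mesh T) (m₀ : P1 d) (b : ℤ) : Prop :=
  ∀ i ∉ box d b, m₀.1.real (cell Δ.dx i) = 0

theorem SolvesCE.eq_zero (hb : InitialSupport Δ m₀ b) {q : Fin Δ.N → Idx d → E d}
    (hq : ∀ k i, q k i ∈ controls d R) {m : Fin (Δ.N + 1) → GridProb d} (hm : SolvesCE Δ m₀ q m)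
    (k : Fin (Δ.N + 1)) : ∀ i ∉ reachBox Δ d R b k, m k i = 0 := by
  induction k using Fin.induction with
  | zero =>
    intro i hi
    rw [hm.2]
    exact hb i (by simpa [reachBox] using hi)
  | succ k ih =>
    intro i hi
    rw [hm.1, ← tsum_zero (α := ℝ) (β := Idx d)]
    refine tsum_congr fun j => ?_
    by_cases hj : j ∈ reachBox Δ d R b k
    · rw [hat_eq_zero_of_notMem_reachBox hj hi (hq k j), zero_mul]
    · rw [ih j hj, mul_zero]

theorem SolvesCE.succ_eq_sum (hb : InitialSupport Δ m₀ b) {q : Fin Δ.N → Idx d → E d}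
    (hq : ∀ k i, q k i ∈ controls d R) {m : Fin (Δ.N + 1) → GridProb d} (hm : SolvesCE Δ m₀ q m)
    (k : Fin Δ.N) (i : Idx d) : m k.succ i
      = ∑ j ∈ reachBox Δ d R b k, hat Δ.dx i (pt Δ.dx j - Δ.dt • q k j) * m k.castSucc j := by
  rw [hm.1]
  exact tsum_eq_sum fun j hj => by rw [hm.eq_zero hb hq k.castSucc j hj, mul_zero]

theorem exists_solvesCE (hb : InitialSupport Δ m₀ b) {z₀ : GridProb d}
    (hz₀ : ∀ i, z₀ i = m₀.1.real (cell Δ.dx i)) {q : Fin Δ.N → Idx d → E d}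
    (hq : ∀ k i, q k i ∈ controls d R) : ∃ m, SolvesCE Δ m₀ q m := by
  -- The step is made total, with a junk value off the expected support, so that the flow can be
  -- defined by recursion first. `hsupp` then shows that the junk value never occurs.
  have hstep : ∀ (k : Fin Δ.N) (z : GridProb d), ∃ z' : GridProb d,
      (∀ i ∉ reachBox Δ d R b k, z i = 0) →
        ∀ i, z' i = ∑' j, hat Δ.dx i (pt Δ.dx j - Δ.dt • q k j) * z j := fun k z => by
    by_cases hz : ∀ i ∉ reachBox Δ d R b k, z i = 0
    · obtain ⟨z', hz'⟩ := exists_transportStep hz (hq k)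
      exact ⟨z', fun _ => hz'⟩
    · exact ⟨z, fun h => absurd h hz⟩
  choose step hstep using hstep
  let m : Fin (Δ.N + 1) → GridProb d := Fin.induction (motive := fun _ => GridProb d) z₀ step
  have hm0 : m 0 = z₀ := rfl
  have hmk : ∀ k : Fin Δ.N, m k.succ = step k (m k.castSucc) := fun k => rfl
  have hsupp : ∀ k : Fin (Δ.N + 1), ∀ i ∉ reachBox Δ d R b k, m k i = 0 := by
    intro k
    induction k using Fin.induction with
    | zero =>
      intro i hi
      rw [hm0, hz₀]
      exact hb i (by simpa [reachBox] using hi)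
    | succ k ih =>
      intro i hi
      rw [hmk, hstep k _ ih, ← tsum_zero (α := ℝ) (β := Idx d)]
      refine tsum_congr fun j => ?_
      by_cases hj : j ∈ reachBox Δ d R b k
      · rw [hat_eq_zero_of_notMem_reachBox hj hi (hq k j), zero_mul]
      · rw [ih j hj, mul_zero]
  exact ⟨m, fun k i => by rw [hmk, hstep k _ (hsupp k.castSucc)], fun i => by rw [hm0, hz₀]⟩

/-! ### The cost of a feedback -/

/-- The excess cost of the feedback `q`, with distribution `m`, over the value function `v`. -/
def gap (Δ : Mesh T) (L : E d → E d → ℝ) (R : ℝ) (b : ℤ) (v : Fin (Δ.N + 1) → Idx d → ℝ)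
    (q : Fin Δ.N → Idx d → E d) (m : Fin (Δ.N + 1) → GridProb d) : ℝ :=
  ∑ k : Fin Δ.N, ∑ i ∈ reachBox Δ d R b k,
    m k.castSucc i * (stepCost Δ L (v k.succ) i (q k i) - minCost Δ L R (v k.succ) i)

/-- The control cost of the feedback `q`, with distribution `m`. -/
def controlCost (Δ : Mesh T) (L : E d → E d → ℝ) (R : ℝ) (b : ℤ)
    (q : Fin Δ.N → Idx d → E d) (m : Fin (Δ.N + 1) → GridProb d) : ℝ :=
  ∑ k : Fin Δ.N, ∑ i ∈ reachBox Δ d R b k, m k.castSucc i * (Δ.dt * L (pt Δ.dx i) (q k i))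

/-- The coupling cost of the flow `m` when the couplings are evaluated at the flow `ν`. -/
def couplingCost (Δ : Mesh T) (F G : E d → P1 d → ℝ) (ν m : Fin (Δ.N + 1) → GridProb d) : ℝ :=
  ∑ k, ∑' i, coupling Δ F G k i (ν k) * m k i

/-- The mean of the value function at the initial time. -/
def meanValue (Δ : Mesh T) (m₀ : P1 d) (b : ℤ) (v : Fin (Δ.N + 1) → Idx d → ℝ) : ℝ :=
  ∑ i ∈ box d b, v 0 i * m₀.1.real (cell Δ.dx i)

theorem gap_nonneg (hL : LagrangianAssumptions L) {v : Fin (Δ.N + 1) → Idx d → ℝ}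
    {q : Fin Δ.N → Idx d → E d} (hq : ∀ k i, q k i ∈ controls d R)
    (m : Fin (Δ.N + 1) → GridProb d) : 0 ≤ gap Δ L R b v q m :=
  Finset.sum_nonneg fun k _ => Finset.sum_nonneg fun i _ =>
    mul_nonneg ((m _).nonneg i) (sub_nonneg.2 (minCost_le hL _ i (hq k i)))

theorem gap_eq_zero {v : Fin (Δ.N + 1) → Idx d → ℝ} {q : Fin Δ.N → Idx d → E d}
    (hq : q ∈ optFeedbacks Δ L R v) (m : Fin (Δ.N + 1) → GridProb d) :
    gap Δ L R b v q m = 0 :=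
  Finset.sum_eq_zero fun k _ => Finset.sum_eq_zero fun i _ => by
    rw [stepCost_eq_minCost (hq k i), sub_self, mul_zero]

theorem GridProb.sum_le_one (z : GridProb d) (S : Finset (Idx d)) : ∑ i ∈ S, z i ≤ 1 := by
  rw [← z.hasSum.tsum_eq]
  exact z.hasSum.summable.sum_le_tsum _ fun i _ => z.nonneg i

theorem gap_le_gap_add (hL : LagrangianAssumptions L) (hR : 0 < R)
    {v v' : Fin (Δ.N + 1) → Idx d → ℝ} {ε : ℝ} (hv : ∀ k i, |v k i - v' k i| ≤ ε)
    (q : Fin Δ.N → Idx d → E d) (m : Fin (Δ.N + 1) → GridProb d) :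
    gap Δ L R b v q m ≤ gap Δ L R b v' q m + Δ.N * (2 * ε) := by
  have hε : 0 ≤ ε := (abs_nonneg _).trans (hv 0 0)
  have h1 : (Δ.N : ℝ) * (2 * ε) = ∑ _k : Fin Δ.N, 2 * ε := by simp
  rw [h1, gap, gap, ← Finset.sum_add_distrib]
  refine Finset.sum_le_sum fun k _ => ?_
  calc _ ≤ ∑ i ∈ reachBox Δ d R b k, (m k.castSucc i *
        (stepCost Δ L (v' k.succ) i (q k i) - minCost Δ L R (v' k.succ) i)
          + m k.castSucc i * (2 * ε)) := by
        refine Finset.sum_le_sum fun i _ => ?_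
        rw [← mul_add]
        exact mul_le_mul_of_nonneg_left (stepCost_sub_minCost_le hL hR (hv k.succ) i _)
          ((m _).nonneg i)
    _ ≤ _ := by
        rw [Finset.sum_add_distrib, ← Finset.sum_mul]
        have := mul_le_mul_of_nonneg_right ((m k.castSucc).sum_le_one (reachBox Δ d R b k))
          (show 0 ≤ 2 * ε by positivity)
        linarith

/-- Pair the value function with `m` at each time. By duality of interpolation and transport, the
pairing changes in one step by the excess cost minus the running costs, and the sum over time
telescopes. The feedback need not be optimal for `v`, nor `m` related to `ν`; this is what permits
comparing responses to different flows. -/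
theorem cost_eq_meanValue_add_gap {ν : Fin (Δ.N + 1) → GridProb d}
    {v : Fin (Δ.N + 1) → Idx d → ℝ} (hv : SolvesHJB Δ L F G R ν v) (hb : InitialSupport Δ m₀ b)
    {q : Fin Δ.N → Idx d → E d} (hq : ∀ k i, q k i ∈ controls d R)
    {m : Fin (Δ.N + 1) → GridProb d} (hm : SolvesCE Δ m₀ q m) :
    controlCost Δ L R b q m + couplingCost Δ F G ν m
      = meanValue Δ m₀ b v + gap Δ L R b v q m := by
  let A : Fin (Δ.N + 1) → ℝ := fun k => ∑ i ∈ reachBox Δ d R b k, v k i * m k i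
  have hH : ∀ k : Fin (Δ.N + 1), ∑' i, coupling Δ F G k i (ν k) * m k i
      = ∑ i ∈ reachBox Δ d R b k, coupling Δ F G k i (ν k) * m k i := fun k =>
    tsum_eq_sum fun i hi => by rw [hm.eq_zero hb hq k i hi, mul_zero]
  have hA0 : A 0 = meanValue Δ m₀ b v := by
    simp only [A, meanValue, hm.2]
    simp [reachBox]
  have hAlast : A (Fin.last _)
      = ∑' i, coupling Δ F G (Fin.last _) i (ν (Fin.last _)) * m (Fin.last _) i := by
    rw [hH]
    exact Finset.sum_congr rfl fun i _ => by rw [hv.eq_last]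
  -- The duality: exchanging the sums moves the hat weights from the mass onto the value function.
  have hnext : ∀ k : Fin Δ.N, A k.succ = ∑ j ∈ reachBox Δ d R b k,
      interp Δ.dx (v k.succ) (pt Δ.dx j - Δ.dt • q k j) * m k.castSucc j := by
    intro k
    simp only [A, hm.succ_eq_sum hb hq, Finset.mul_sum]
    rw [Finset.sum_comm]
    refine Finset.sum_congr rfl fun j hj => ?_
    rw [interp_eq_sum fun i hi => hat_eq_zero_of_notMem_reachBox hj hi (hq k j), Finset.sum_mul]
    exact Finset.sum_congr rfl fun i _ => (mul_assoc _ _ _).symm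
  have hk : ∀ k : Fin Δ.N, ∑ i ∈ reachBox Δ d R b k,
      m k.castSucc i * (stepCost Δ L (v k.succ) i (q k i) - minCost Δ L R (v k.succ) i)
      = A k.succ - A k.castSucc
        + ∑ i ∈ reachBox Δ d R b k, m k.castSucc i * (Δ.dt * L (pt Δ.dx i) (q k i))
        + ∑' i, coupling Δ F G k.castSucc i (ν k.castSucc) * m k.castSucc i := by
    intro k
    rw [hnext, hH]
    simp only [A, Fin.val_castSucc]
    rw [← Finset.sum_sub_distrib, ← Finset.sum_add_distrib, ← Finset.sum_add_distrib]
    refine Finset.sum_congr rfl fun i _ => ?_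
    rw [hv.eq_castSucc, stepCost]
    ring
  have htel : ∑ k : Fin Δ.N, (A k.succ - A k.castSucc) = A (Fin.last _) - A 0 := by
    rw [Finset.sum_sub_distrib]
    have h1 := Fin.sum_univ_succ A
    have h2 := Fin.sum_univ_castSucc A
    linarith
  rw [gap, Finset.sum_congr rfl fun k _ => hk k, Finset.sum_add_distrib, Finset.sum_add_distrib,
    htel, hAlast, hA0, couplingCost, Fin.sum_univ_castSucc, controlCost]
  ring

/-! ### Stability of the transport of optimal feedbacks -/

/-- `D k j a` is the change in the transition weights out of `j` when the control `a` replaces the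
optimal one. It is at most `η / N` plus a multiple of the excess cost at `j`; summed against `m'`,
the latter becomes a part of `gap`. Errors accumulate over at most `N` steps, and finiteness of the
boxes gives one constant `M` for all sites. -/
theorem exists_transport_stability (hS : IsRegularSystem Δ L F G R) (hb : InitialSupport Δ m₀ b)
    {ν : Fin (Δ.N + 1) → GridProb d} {v : Fin (Δ.N + 1) → Idx d → ℝ}
    (hv : SolvesHJB Δ L F G R ν v) {q : Fin Δ.N → Idx d → E d} (hq : q ∈ optFeedbacks Δ L R v)
    {m : Fin (Δ.N + 1) → GridProb d} (hm : SolvesCE Δ m₀ q m) {η : ℝ} (hη : 0 < η) :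
    ∃ C, 0 ≤ C ∧ ∀ q' m', (∀ k i, q' k i ∈ controls d R) → SolvesCE Δ m₀ q' m' →
      ∀ k : Fin (Δ.N + 1), ∑ i ∈ reachBox Δ d R b k, |m' k i - m k i| ≤ η + C * gap Δ L R b v q' m' := by
  have hqc : ∀ k i, q k i ∈ controls d R := fun k i => (hq k i).1
  have hN : (0 : ℝ) < Δ.N := by exact_mod_cast Δ.N_pos
  let D : Fin Δ.N → Idx d → E d → ℝ := fun k j a => ∑ i ∈ reachBox Δ d R b (k + 1),
    |hat Δ.dx i (pt Δ.dx j - Δ.dt • a) - hat Δ.dx i (pt Δ.dx j - Δ.dt • q k j)|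
  have hD : ∀ k j, ∃ C, 0 ≤ C ∧ ∀ a ∈ controls d R, D k j a
      ≤ η / Δ.N + C * (stepCost Δ L (v k.succ) j a - minCost Δ L R (v k.succ) j) := by
    intro k j
    refine exists_le_add_mul_stepCost hS hv hq k j ?_ (by simp [D]) (by positivity)
    refine continuous_finsetSum _ fun i _ => (Continuous.sub ((continuous_hat _ _).comp ?_)
      continuous_const).abs
    fun_prop
  choose C hC hDC using hD
  let M : ℝ := ∑ k : Fin Δ.N, ∑ j ∈ reachBox Δ d R b k, C k j
  have hM : 0 ≤ M := Finset.sum_nonneg fun k _ => Finset.sum_nonneg fun j _ => hC k j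
  have hCM : ∀ k : Fin Δ.N, ∀ j ∈ reachBox Δ d R b k, C k j ≤ M := fun k j hj =>
    (Finset.single_le_sum (f := fun j => C k j) (fun j _ => hC k j) hj).trans
      (Finset.single_le_sum (f := fun k : Fin Δ.N => ∑ j ∈ reachBox Δ d R b k, C k j)
        (fun k _ => Finset.sum_nonneg fun j _ => hC k j) (Finset.mem_univ k))
  refine ⟨Δ.N * M, by positivity, fun q' m' hq' hm' => ?_⟩
  have hg := gap_nonneg (b := b) hS.lagrangian (v := v) hq' m'
  have hnn : ∀ k i, 0 ≤ m' k.castSucc i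
      * (stepCost Δ L (v k.succ) i (q' k i) - minCost Δ L R (v k.succ) i) := fun k i =>
    mul_nonneg ((m' _).nonneg i) (sub_nonneg.2 (minCost_le hS.lagrangian _ i (hq' k i)))
  have hgk : ∀ k : Fin Δ.N, ∑ i ∈ reachBox Δ d R b k, m' k.castSucc i
      * (stepCost Δ L (v k.succ) i (q' k i) - minCost Δ L R (v k.succ) i) ≤ gap Δ L R b v q' m' :=
    fun k => Finset.single_le_sum (f := fun k : Fin Δ.N => ∑ i ∈ reachBox Δ d R b k,
      m' k.castSucc i * (stepCost Δ L (v k.succ) i (q' k i) - minCost Δ L R (v k.succ) i))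
      (fun k _ => Finset.sum_nonneg fun i _ => hnn k i) (Finset.mem_univ k)
  have key : ∀ k : Fin (Δ.N + 1), ∑ i ∈ reachBox Δ d R b k, |m' k i - m k i|
      ≤ (k : ℕ) * (η / Δ.N + M * gap Δ L R b v q' m') := by
    intro k
    induction k using Fin.induction with
    | zero => simp [hm.2, hm'.2]
    | succ k ih =>
      have hterm : ∀ j ∈ reachBox Δ d R b k, ∑ i ∈ reachBox Δ d R b (k + 1),
          |hat Δ.dx i (pt Δ.dx j - Δ.dt • q' k j) * m' k.castSucc j
            - hat Δ.dx i (pt Δ.dx j - Δ.dt • q k j) * m k.castSucc j|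
          ≤ |m' k.castSucc j - m k.castSucc j| + (m' k.castSucc j * (η / Δ.N)
            + M * (m' k.castSucc j * (stepCost Δ L (v k.succ) j (q' k j)
              - minCost Δ L R (v k.succ) j))) := by
        intro j hj
        have hD1 := hDC k j (q' k j) (hq' k j)
        have hD2 : D k j (q' k j) ≤ η / Δ.N + M * (stepCost Δ L (v k.succ) j (q' k j)
            - minCost Δ L R (v k.succ) j) :=
          hD1.trans (add_le_add le_rfl (mul_le_mul_of_nonneg_right (hCM k j hj)
            (sub_nonneg.2 (minCost_le hS.lagrangian _ j (hq' k j)))))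
        have h1 : ∑ i ∈ reachBox Δ d R b (k + 1), hat Δ.dx i (pt Δ.dx j - Δ.dt • q k j) = 1 :=
          sum_hat_eq_one Δ.dx_pos fun i hi => hat_eq_zero_of_notMem_reachBox hj hi (hqc k j)
        -- The split is `a' m' - a m = a (m' - m) + m' (a' - a)`. The change of weights must be
        -- multiplied by `m'`, not `m`, because `gap` is an average against `m'`.
        calc _ ≤ ∑ i ∈ reachBox Δ d R b (k + 1),
              (hat Δ.dx i (pt Δ.dx j - Δ.dt • q k j) * |m' k.castSucc j - m k.castSucc j|
              + m' k.castSucc j * |hat Δ.dx i (pt Δ.dx j - Δ.dt • q' k j)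
                - hat Δ.dx i (pt Δ.dx j - Δ.dt • q k j)|) := by
              refine Finset.sum_le_sum fun i _ => ?_
              rw [← abs_of_nonneg (hat_nonneg Δ.dx i (pt Δ.dx j - Δ.dt • q k j)),
                ← abs_mul, abs_of_nonneg (hat_nonneg Δ.dx i (pt Δ.dx j - Δ.dt • q k j))]
              nth_rewrite 3 [← abs_of_nonneg ((m' k.castSucc).nonneg j)]
              rw [← abs_mul]
              refine le_trans (le_of_eq ?_) (abs_add_le _ _)
              congr 1
              ring
          _ = |m' k.castSucc j - m k.castSucc j| + m' k.castSucc j * D k j (q' k j) := by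
              rw [Finset.sum_add_distrib, ← Finset.sum_mul, h1, one_mul, ← Finset.mul_sum]
          _ ≤ _ := by
              have := mul_le_mul_of_nonneg_left hD2 ((m' k.castSucc).nonneg j)
              linarith
      calc ∑ i ∈ reachBox Δ d R b (k.succ : Fin (Δ.N + 1)), |m' k.succ i - m k.succ i|
          ≤ ∑ i ∈ reachBox Δ d R b (k + 1), ∑ j ∈ reachBox Δ d R b k,
            |hat Δ.dx i (pt Δ.dx j - Δ.dt • q' k j) * m' k.castSucc j
            - hat Δ.dx i (pt Δ.dx j - Δ.dt • q k j) * m k.castSucc j| := by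
            rw [Fin.val_succ]
            refine Finset.sum_le_sum fun i _ => ?_
            rw [hm.succ_eq_sum hb hqc, hm'.succ_eq_sum hb hq', ← Finset.sum_sub_distrib]
            exact Finset.abs_sum_le_sum_abs _ _
        _ ≤ ∑ j ∈ reachBox Δ d R b k, (|m' k.castSucc j - m k.castSucc j|
            + (m' k.castSucc j * (η / Δ.N) + M * (m' k.castSucc j *
              (stepCost Δ L (v k.succ) j (q' k j) - minCost Δ L R (v k.succ) j)))) := by
            rw [Finset.sum_comm]
            exact Finset.sum_le_sum hterm
        _ ≤ (k : ℕ) * (η / Δ.N + M * gap Δ L R b v q' m')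
            + (1 * (η / Δ.N) + M * gap Δ L R b v q' m') := by
            rw [Finset.sum_add_distrib, Finset.sum_add_distrib, ← Finset.sum_mul, ← Finset.mul_sum]
            refine add_le_add ih (add_le_add (mul_le_mul_of_nonneg_right
              ((m' _).sum_le_one _) (by positivity)) (mul_le_mul_of_nonneg_left (hgk k) hM))
        _ = _ := by rw [Fin.val_succ]; push_cast; ring
  intro k
  have hkN : ((k : ℕ) : ℝ) ≤ Δ.N := by exact_mod_cast Nat.lt_succ_iff.1 k.2
  refine (key k).trans ((mul_le_mul_of_nonneg_right hkN (by positivity)).trans (le_of_eq ?_))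
  field_simp

/-- With zero gap, stability leaves an arbitrary `η`. The feedbacks may still differ where `m'` has
no mass, so the comparison is of flows and not of controls. -/
theorem SolvesCE.eq_of_gap_eq_zero (hS : IsRegularSystem Δ L F G R) (hb : InitialSupport Δ m₀ b)
    {ν : Fin (Δ.N + 1) → GridProb d} {v : Fin (Δ.N + 1) → Idx d → ℝ}
    (hv : SolvesHJB Δ L F G R ν v) {q q' : Fin Δ.N → Idx d → E d}
    (hq : q ∈ optFeedbacks Δ L R v) (hq' : ∀ k i, q' k i ∈ controls d R)
    {m m' : Fin (Δ.N + 1) → GridProb d} (hm : SolvesCE Δ m₀ q m) (hm' : SolvesCE Δ m₀ q' m')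
    (hgap : gap Δ L R b v q' m' ≤ 0) : m' = m := by
  have hg := le_antisymm hgap (gap_nonneg (b := b) hS.lagrangian (v := v) hq' m')
  funext k
  refine GridProb.ext (funext fun i => ?_)
  by_cases hi : i ∈ reachBox Δ d R b k
  · have h0 : |m' k i - m k i| ≤ 0 := le_of_forall_pos_le_add fun η hη => by
      obtain ⟨C, -, hC⟩ := exists_transport_stability hS hb hv hq hm hη
      have := hC q' m' hq' hm' k
      rw [hg, mul_zero, add_zero] at this
      rw [zero_add]
      exact (Finset.single_le_sum (f := fun i => |m' k i - m k i|)
        (fun _ _ => abs_nonneg _) hi).trans this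
    exact sub_eq_zero.1 (abs_nonpos_iff.1 h0)
  · rw [hm.eq_zero hb (fun k i => (hq k i).1) k i hi, hm'.eq_zero hb hq' k i hi]

end

section

variable {d : ℕ} {T : ℝ} {Δ : Mesh T} {L : E d → E d → ℝ} {F G : E d → P1 d → ℝ} {R : ℝ}
  {m₀ : P1 d} {b : ℤ}

/-! ### The coupling cost -/

theorem summable_coupling_mul (hS : IsRegularSystem Δ L F G R) (k : Fin (Δ.N + 1))
    (z z' : GridProb d) : Summable fun i => coupling Δ F G k i z * z' i := by
  obtain ⟨C, -, hC⟩ := (hS.coupling k).bdd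
  exact summable_mul_of_bdd (fun i => hC i z) z'.hasSum.summable

theorem couplingCost_linear (hS : IsRegularSystem Δ L F G R) {x y : ℝ}
    {m m' m'' : Fin (Δ.N + 1) → GridProb d} (h : ∀ k i, x * m'' k i = y * m k i + m' k i)
    (ν : Fin (Δ.N + 1) → GridProb d) :
    x * couplingCost Δ F G ν m'' = y * couplingCost Δ F G ν m + couplingCost Δ F G ν m' := by
  simp only [couplingCost, Finset.mul_sum]
  rw [← Finset.sum_add_distrib]
  refine Finset.sum_congr rfl fun k _ => ?_
  rw [← tsum_mul_left, ← tsum_mul_left, ← ((summable_coupling_mul hS k _ _).mul_left y).tsum_add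
    (summable_coupling_mul hS k _ _)]
  refine tsum_congr fun i => ?_
  rw [mul_left_comm, h]
  ring

theorem couplingCost_monotone (hS : IsRegularSystem Δ L F G R)
    (ν ν' : Fin (Δ.N + 1) → GridProb d) :
    0 ≤ couplingCost Δ F G ν ν - couplingCost Δ F G ν' ν
      - (couplingCost Δ F G ν ν' - couplingCost Δ F G ν' ν') := by
  simp only [couplingCost, ← Finset.sum_sub_distrib]
  refine Finset.sum_nonneg fun k _ => ((hS.coupling k).mono (ν k) (ν' k)).trans (le_of_eq ?_)
  have hs := summable_coupling_mul hS k
  rw [← (hs _ _).tsum_sub (hs _ _), ← (hs _ _).tsum_sub (hs _ _),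
    ← ((hs _ _).sub (hs _ _)).tsum_sub ((hs _ _).sub (hs _ _))]
  exact tsum_congr fun i => by ring

theorem exists_abs_couplingCost_le (hS : IsRegularSystem Δ L F G R) :
    ∃ C, ∀ ν m, |couplingCost Δ F G ν m| ≤ C := by
  choose C hC hbdd using fun k => (hS.coupling k).bdd
  refine ⟨∑ k, C k, fun ν m => (Finset.abs_sum_le_sum_abs _ _).trans
    (Finset.sum_le_sum fun k _ => ?_)⟩
  have := tsum_of_norm_bounded ((m k).hasSum.mul_left (C k))
    (f := fun i => coupling Δ F G k i (ν k) * m k i) fun i => by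
      rw [norm_mul, Real.norm_of_nonneg ((m k).nonneg i)]
      exact mul_le_mul_of_nonneg_right (hbdd k i _) ((m k).nonneg i)
  simpa using this

theorem SolvesCE.couplingCost_eq (hb : InitialSupport Δ m₀ b) {q : Fin Δ.N → Idx d → E d}
    (hq : ∀ k i, q k i ∈ controls d R) {m : Fin (Δ.N + 1) → GridProb d} (hm : SolvesCE Δ m₀ q m)
    (ν : Fin (Δ.N + 1) → GridProb d) : couplingCost Δ F G ν m
      = ∑ k : Fin (Δ.N + 1), ∑ i ∈ reachBox Δ d R b k, coupling Δ F G k i (ν k) * m k i :=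
  Finset.sum_congr rfl fun k _ =>
    tsum_eq_sum fun i hi => by rw [hm.eq_zero hb hq k i hi, mul_zero]

/-- The `ℓ¹` distance of two flows on the boxes which contain the supports of transports. -/
def boxDist (Δ : Mesh T) (R : ℝ) (b : ℤ) (m m' : Fin (Δ.N + 1) → GridProb d) : ℝ :=
  ∑ k : Fin (Δ.N + 1), ∑ i ∈ reachBox Δ d R b k, |m k i - m' k i|

theorem boxDist_nonneg (m m' : Fin (Δ.N + 1) → GridProb d) : 0 ≤ boxDist Δ R b m m' :=
  Finset.sum_nonneg fun _ _ => Finset.sum_nonneg fun _ _ => abs_nonneg _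

theorem boxDist_triangle_right (m m' m'' : Fin (Δ.N + 1) → GridProb d) :
    boxDist Δ R b m m' ≤ boxDist Δ R b m m'' + boxDist Δ R b m' m'' := by
  simp only [boxDist, ← Finset.sum_add_distrib]
  refine Finset.sum_le_sum fun k _ => Finset.sum_le_sum fun i _ => ?_
  rw [abs_sub_comm (m' k i)]
  exact abs_sub_le _ _ _

/-- A mixed second difference is bounded by a product of two distances. Along the iteration one
factor is `O(1/p)` and absorbs the weight `p + 2`, while the other tends to 0. -/
theorem exists_couplingCost_lipschitz (hS : IsRegularSystem Δ L F G R)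
    (hb : InitialSupport Δ m₀ b) :
    ∃ K, 0 ≤ K ∧ ∀ ν ν' q q' m m', (∀ k i, q k i ∈ controls d R) →
      (∀ k i, q' k i ∈ controls d R) → SolvesCE Δ m₀ q m → SolvesCE Δ m₀ q' m' →
      couplingCost Δ F G ν m - couplingCost Δ F G ν' m
        - (couplingCost Δ F G ν m' - couplingCost Δ F G ν' m')
        ≤ K * flowDist ν ν' * boxDist Δ R b m m' := by
  obtain ⟨K, hK, hlip⟩ := exists_coupling_lipschitz hS
  refine ⟨K, hK, fun ν ν' q q' m m' hq hq' hm hm' => ?_⟩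
  simp only [hm.couplingCost_eq hb hq, hm'.couplingCost_eq hb hq', boxDist,
    ← Finset.sum_sub_distrib, Finset.mul_sum]
  refine Finset.sum_le_sum fun k _ => Finset.sum_le_sum fun i _ => ?_
  calc _ = (coupling Δ F G k i (ν k) - coupling Δ F G k i (ν' k)) * (m k i - m' k i) := by ring
    _ ≤ |coupling Δ F G k i (ν k) - coupling Δ F G k i (ν' k)| * |m k i - m' k i| := by
        rw [← abs_mul]; exact le_abs_self _
    _ ≤ _ := mul_le_mul_of_nonneg_right (hlip ν ν' k i) (abs_nonneg _)

/-! ### Continuity of the best response -/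

/-- The constant may depend on `η`: the limit in `g` is taken before `η` is made small. The
compactness estimates above have exactly this form. -/
theorem tendsto_zero_of_le_add_mul {α : Type*} {l : Filter α} {f g : α → ℝ}
    (hf : ∀ᶠ n in l, 0 ≤ f n) (hg : Tendsto g l (𝓝 0))
    (h : ∀ η > 0, ∃ C, ∀ᶠ n in l, f n ≤ η + C * g n) : Tendsto f l (𝓝 0) := by
  rw [Metric.tendsto_nhds]
  intro ε hε
  obtain ⟨C, hC⟩ := h (ε / 2) (by positivity)
  have h1 : Tendsto (fun n => C * g n) l (𝓝 0) := by simpa using hg.const_mul C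
  filter_upwards [hf, hC, h1.eventually (gt_mem_nhds (half_pos hε))] with n h2 h3 h4
  rw [Real.dist_eq, sub_zero, abs_of_nonneg h2]
  linarith

/-- `m` is the distribution of the optimal feedback `q` for the value function `v` of `ν`. -/
structure IsBestResponse (Δ : Mesh T) (L : E d → E d → ℝ) (F G : E d → P1 d → ℝ) (R : ℝ)
    (m₀ : P1 d) (ν : Fin (Δ.N + 1) → GridProb d) (v : Fin (Δ.N + 1) → Idx d → ℝ)
    (q : Fin Δ.N → Idx d → E d) (m : Fin (Δ.N + 1) → GridProb d) : Prop where
  hjb : SolvesHJB Δ L F G R ν v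
  opt : q ∈ optFeedbacks Δ L R v
  ce : SolvesCE Δ m₀ q m

theorem IsBestResponse.mem_controls {ν m : Fin (Δ.N + 1) → GridProb d}
    {v : Fin (Δ.N + 1) → Idx d → ℝ} {q : Fin Δ.N → Idx d → E d}
    (h : IsBestResponse Δ L F G R m₀ ν v q m) (k : Fin Δ.N) (i : Idx d) : q k i ∈ controls d R :=
  (h.opt k i).1

section Continuity

variable {α : Type*} {l : Filter α} {νn mn : α → Fin (Δ.N + 1) → GridProb d}
  {vn : α → Fin (Δ.N + 1) → Idx d → ℝ} {qn : α → Fin Δ.N → Idx d → E d}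
  {ν m : Fin (Δ.N + 1) → GridProb d} {v : Fin (Δ.N + 1) → Idx d → ℝ} {q : Fin Δ.N → Idx d → E d}

theorem tendstoUniformly_value (hS : IsRegularSystem Δ L F G R)
    (hn : ∀ n, SolvesHJB Δ L F G R (νn n) (vn n)) (h : SolvesHJB Δ L F G R ν v)
    (hlim : Tendsto (fun n => flowDist (νn n) ν) l (𝓝 0)) (k : Fin (Δ.N + 1)) :
    TendstoUniformly (fun n i => vn n k i) (fun i => v k i) l := by
  obtain ⟨K, -, hlip⟩ := exists_solvesHJB_lipschitz hS
  rw [Metric.tendstoUniformly_iff]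
  intro ε hε
  have h1 : Tendsto (fun n => K * flowDist (νn n) ν) l (𝓝 0) := by simpa using hlim.const_mul K
  filter_upwards [h1.eventually (gt_mem_nhds hε)] with n hn' i
  rw [dist_comm, Real.dist_eq]
  exact (hlip _ _ _ _ (hn n) h k i).trans_lt hn'

theorem tendsto_control (hS : IsRegularSystem Δ L F G R)
    (hn : ∀ n, IsBestResponse Δ L F G R m₀ (νn n) (vn n) (qn n) (mn n))
    (h : IsBestResponse Δ L F G R m₀ ν v q m)
    (hlim : Tendsto (fun n => flowDist (νn n) ν) l (𝓝 0)) (k : Fin Δ.N) (i : Idx d) :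
    Tendsto (fun n => qn n k i) l (𝓝 (q k i)) := by
  obtain ⟨K, -, hlip⟩ := exists_solvesHJB_lipschitz hS
  have hlip' : ∀ n k i, |v k i - vn n k i| ≤ K * flowDist (νn n) ν := fun n k i => by
    rw [abs_sub_comm]; exact hlip _ _ _ _ (hn n).hjb h.hjb k i
  rw [tendsto_iff_norm_sub_tendsto_zero]
  refine tendsto_zero_of_le_add_mul (Eventually.of_forall fun _ => norm_nonneg _) hlim
    fun η hη => ?_
  obtain ⟨C, hC0, hC⟩ := exists_le_add_mul_stepCost hS h.hjb h.opt k i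
    (D := fun a => ‖a - q k i‖) (by fun_prop) (by simp) hη
  refine ⟨C * (2 * K), Eventually.of_forall fun n => (hC _ ((hn n).mem_controls k i)).trans ?_⟩
  have h1 := stepCost_sub_minCost_le (Δ := Δ) hS.lagrangian hS.pos
    (hlip' n k.succ) i (qn n k i)
  rw [stepCost_eq_minCost ((hn n).opt k i), sub_self, zero_add] at h1
  have h2 := mul_le_mul_of_nonneg_left h1 hC0
  linarith

/-- The feedback `qn n` has zero gap for `vn n`, hence a gap for `v` of the order of the distance of
the value functions, and stability applies. -/
theorem tendsto_boxDist (hS : IsRegularSystem Δ L F G R) (hb : InitialSupport Δ m₀ b)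
    (hn : ∀ n, IsBestResponse Δ L F G R m₀ (νn n) (vn n) (qn n) (mn n))
    (h : IsBestResponse Δ L F G R m₀ ν v q m)
    (hlim : Tendsto (fun n => flowDist (νn n) ν) l (𝓝 0)) :
    Tendsto (fun n => boxDist Δ R b (mn n) m) l (𝓝 0) := by
  obtain ⟨K, -, hlip⟩ := exists_solvesHJB_lipschitz hS
  have hlip' : ∀ n k i, |v k i - vn n k i| ≤ K * flowDist (νn n) ν := fun n k i => by
    rw [abs_sub_comm]; exact hlip _ _ _ _ (hn n).hjb h.hjb k i
  unfold boxDist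
  rw [← Finset.sum_const_zero (s := (Finset.univ : Finset (Fin (Δ.N + 1))))]
  refine tendsto_finsetSum _ fun k _ => ?_
  refine tendsto_zero_of_le_add_mul
    (Eventually.of_forall fun _ => Finset.sum_nonneg fun _ _ => abs_nonneg _) hlim fun η hη => ?_
  obtain ⟨C, hC0, hC⟩ := exists_transport_stability hS hb h.hjb h.opt h.ce hη
  refine ⟨C * (Δ.N * (2 * K)), Eventually.of_forall fun n =>
    (hC _ _ (hn n).mem_controls (hn n).ce k).trans ?_⟩
  have h1 := gap_le_gap_add (b := b) hS.lagrangian hS.pos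
    (hlip' n) (qn n) (mn n)
  rw [gap_eq_zero (hn n).opt, zero_add] at h1
  have h2 := mul_le_mul_of_nonneg_left h1 hC0
  linarith

end Continuity

theorem exists_isBestResponse (hS : IsRegularSystem Δ L F G R) (hb : InitialSupport Δ m₀ b)
    {z₀ : GridProb d} (hz₀ : ∀ i, z₀ i = m₀.1.real (cell Δ.dx i))
    (ν : Fin (Δ.N + 1) → GridProb d) : ∃ v q m, IsBestResponse Δ L F G R m₀ ν v q m := by
  obtain ⟨v, hv⟩ := exists_solvesHJB hS ν
  obtain ⟨q, hq⟩ := exists_optFeedback hS hv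
  obtain ⟨m, hm⟩ := exists_solvesCE hb hz₀ (q := q) fun k i => (hq k i).1
  exact ⟨v, q, m, hv, hq, hm⟩

theorem IsBestResponse.meanValue_eq {ν m : Fin (Δ.N + 1) → GridProb d}
    {v : Fin (Δ.N + 1) → Idx d → ℝ} {q : Fin Δ.N → Idx d → E d}
    (h : IsBestResponse Δ L F G R m₀ ν v q m) (hb : InitialSupport Δ m₀ b) :
    meanValue Δ m₀ b v = controlCost Δ L R b q m + couplingCost Δ F G ν m := by
  rw [cost_eq_meanValue_add_gap h.hjb hb h.mem_controls h.ce, gap_eq_zero h.opt, add_zero]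

/-! ### Solutions of the discrete mean field game system -/

theorem solvesMFG_iff {m : Fin (Δ.N + 1) → GridProb d}
    {v : Fin (Δ.N + 1) → Idx d → ℝ} :
    SolvesMFG Δ L F G m₀ R m v ↔ ∃ q, IsBestResponse Δ L F G R m₀ m v q m := by
  constructor
  · rintro ⟨hbdd, q, hq, h1, h2, h3⟩
    refine ⟨q, ⟨hbdd, fun k i => ?_, h2⟩, hq, h3⟩
    rw [h1, stepCost_eq_minCost (hq k i)]
    rfl
  · rintro ⟨q, hv, hq, hm⟩
    refine ⟨hv.1, q, hq, fun k i => ?_, hv.2.2, hm⟩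
    rw [stepCost_eq_minCost (hq k i)]
    exact hv.2.1 k i

/-- The Lasry-Lions argument: testing each solution against the other's value function and adding,
the sum of the two gaps is minus the monotonicity expression. Both gaps therefore vanish. -/
theorem solution_unique (hS : IsRegularSystem Δ L F G R) (hb : InitialSupport Δ m₀ b)
    {m m' : Fin (Δ.N + 1) → GridProb d} {v v' : Fin (Δ.N + 1) → Idx d → ℝ}
    {q q' : Fin Δ.N → Idx d → E d} (h : IsBestResponse Δ L F G R m₀ m v q m)
    (h' : IsBestResponse Δ L F G R m₀ m' v' q' m') : m' = m := by
  refine h.ce.eq_of_gap_eq_zero hS hb h.hjb h.opt h'.mem_controls h'.ce ?_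
  have h1 := cost_eq_meanValue_add_gap h.hjb hb h'.mem_controls h'.ce
  have h2 := cost_eq_meanValue_add_gap h'.hjb hb h.mem_controls h.ce
  have h3 := h.meanValue_eq hb
  have h4 := h'.meanValue_eq hb
  have h5 := couplingCost_monotone hS m m'
  have h6 := gap_nonneg (b := b) hS.lagrangian (v := v') h.mem_controls m
  linarith

/-! ### The iteration -/

/-- The iteration, indexed from `0`: `ν p` is the average of `ν 0` and of the best responses
`m 0, …, m (p - 1)`. -/
structure IsLearning (Δ : Mesh T) (L : E d → E d → ℝ) (F G : E d → P1 d → ℝ) (R : ℝ)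
    (m₀ : P1 d) (ν : ℕ → Fin (Δ.N + 1) → GridProb d) (v : ℕ → Fin (Δ.N + 1) → Idx d → ℝ)
    (q : ℕ → Fin Δ.N → Idx d → E d) (m : ℕ → Fin (Δ.N + 1) → GridProb d) : Prop where
  response : ∀ p, IsBestResponse Δ L F G R m₀ (ν p) (v p) (q p) (m p)
  average : ∀ (p : ℕ) k i, ((p : ℝ) + 2) * ν (p + 1) k i = ((p : ℝ) + 1) * ν p k i + m p k i

/-- The weighted mean of two grid distributions. -/
theorem exists_average (p : ℕ) (z z' : GridProb d) :
    ∃ w : GridProb d, ∀ i, ((p : ℝ) + 2) * w i = ((p : ℝ) + 1) * z i + z' i := by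
  have hp : (p : ℝ) + 2 ≠ 0 := by positivity
  refine ⟨⟨fun i => ((p : ℝ) + 2)⁻¹ * (((p : ℝ) + 1) * z i + z' i), fun i => ?_, ?_, ?_⟩,
    fun i => by simp only; rw [mul_inv_cancel_left₀ hp]⟩
  · have := z.nonneg i
    have := z'.nonneg i
    positivity
  · have := ((z.hasSum.mul_left ((p : ℝ) + 1)).add z'.hasSum).mul_left ((p : ℝ) + 2)⁻¹
    rwa [show ((p : ℝ) + 2)⁻¹ * (((p : ℝ) + 1) * 1 + 1) = 1 by field_simp; ring] at this
  · refine (((z.moment.mul_left ((p : ℝ) + 1)).add z'.moment).mul_left ((p : ℝ) + 2)⁻¹).congr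
      fun i => ?_
    ring

theorem exists_isLearning (hS : IsRegularSystem Δ L F G R) (hb : InitialSupport Δ m₀ b)
    {z₀ : GridProb d} (hz₀ : ∀ i, z₀ i = m₀.1.real (cell Δ.dx i))
    (ν₀ : Fin (Δ.N + 1) → GridProb d) :
    ∃ ν v q m, ν 0 = ν₀ ∧ IsLearning Δ L F G R m₀ ν v q m := by
  choose v q m h using exists_isBestResponse hS hb hz₀
  choose w hw using fun (p : ℕ) (z z' : GridProb d) => exists_average p z z'
  let ν : ℕ → Fin (Δ.N + 1) → GridProb d := fun p => Nat.rec (motive := fun _ => _) ν₀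
    (fun p ν k => w p (ν k) (m ν k)) p
  exact ⟨ν, fun p => v (ν p), fun p => q (ν p), fun p => m (ν p), rfl, fun p => h (ν p),
    fun p k i => hw p _ _ i⟩

end

section

variable {d : ℕ} {T : ℝ} {Δ : Mesh T} {L : E d → E d → ℝ} {F G : E d → P1 d → ℝ} {R : ℝ}
  {m₀ : P1 d} {b : ℤ} {ν : ℕ → Fin (Δ.N + 1) → GridProb d} {v : ℕ → Fin (Δ.N + 1) → Idx d → ℝ}
  {q : ℕ → Fin Δ.N → Idx d → E d} {m : ℕ → Fin (Δ.N + 1) → GridProb d}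

/-! ### Averages of the responses: domination, increments and limit points -/

namespace IsLearning

theorem eq_sum (h : IsLearning Δ L F G R m₀ ν v q m) (p : ℕ) (k : Fin (Δ.N + 1)) (i : Idx d) :
    ((p : ℝ) + 1) * ν p k i = ν 0 k i + ∑ s ∈ Finset.range p, m s k i := by
  induction p with
  | zero => simp
  | succ p ih =>
    rw [Finset.sum_range_succ, ← add_assoc, ← ih, ← h.average]
    push_cast
    ring

theorem couplingCost_eq_sum (hS : IsRegularSystem Δ L F G R)
    (h : IsLearning Δ L F G R m₀ ν v q m) (p : ℕ) (ν' : Fin (Δ.N + 1) → GridProb d) :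
    ((p : ℝ) + 1) * couplingCost Δ F G ν' (ν p)
      = couplingCost Δ F G ν' (ν 0) + ∑ s ∈ Finset.range p, couplingCost Δ F G ν' (m s) := by
  induction p with
  | zero => simp
  | succ p ih =>
    rw [Finset.sum_range_succ, ← add_assoc, ← ih, ← couplingCost_linear hS (h.average p)]
    push_cast
    ring

/-- The average is a convex combination of the initial guess and of responses supported in the box.
The bound does not depend on `p`, so it prevents loss of mass or of first moment in the limit. -/
theorem le_dominating (h : IsLearning Δ L F G R m₀ ν v q m) (hb : InitialSupport Δ m₀ b) (p : ℕ)
    (k : Fin (Δ.N + 1)) (i : Idx d) :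
    ν p k i ≤ ν 0 k i + if i ∈ reachBox Δ d R b k then 1 else 0 := by
  have h0 := (ν 0 k).nonneg i
  have hsum := h.eq_sum p k i
  have h1 : ∑ s ∈ Finset.range p, m s k i ≤ p * if i ∈ reachBox Δ d R b k then 1 else 0 := by
    calc _ ≤ ∑ _s ∈ Finset.range p, if i ∈ reachBox Δ d R b k then (1 : ℝ) else 0 := by
          refine Finset.sum_le_sum fun s _ => ?_
          split_ifs with hi
          · exact (m s k).le_one i
          · exact ((h.response s).ce.eq_zero hb (h.response s).mem_controls k i hi).le
      _ = _ := by rw [Finset.sum_const, Finset.card_range, nsmul_eq_mul]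
  have hp : (0 : ℝ) < p + 1 := by positivity
  have h2 : (0 : ℝ) ≤ if i ∈ reachBox Δ d R b k then 1 else 0 := by split_ifs <;> norm_num
  have h3 : (0 : ℝ) ≤ p * ν 0 k i := by positivity
  refine le_of_mul_le_mul_left ?_ hp
  rw [hsum]
  linarith

theorem summable_dominating (z : GridProb d) (S : Finset (Idx d)) :
    Summable fun i => (1 + ‖i‖) * (z i + if i ∈ S then 1 else 0) := by
  simp only [mul_add (1 + ‖_‖)]
  exact z.summable_weight.add (summable_of_ne_finset_zero (s := S) fun i hi => by simp [hi])

/-- By the averaging rule, `(p + 2) (ν (p + 1) - ν p) = m p - ν p`, and the right side is dominated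
uniformly in `p`. -/
theorem exists_flowDist_succ_le (h : IsLearning Δ L F G R m₀ ν v q m)
    (hb : InitialSupport Δ m₀ b) :
    ∃ D, 0 ≤ D ∧ ∀ p : ℕ, ((p : ℝ) + 2) * flowDist (ν (p + 1)) (ν p) ≤ D := by
  have hnn : ∀ (k : Fin (Δ.N + 1)) (i : Idx d),
      0 ≤ (1 + ‖i‖) * (ν 0 k i + if i ∈ reachBox Δ d R b k then 1 else 0) := fun k i =>
    mul_nonneg (by positivity) (add_nonneg ((ν 0 k).nonneg i) (by split_ifs <;> norm_num))
  refine ⟨∑ k : Fin (Δ.N + 1), ∑' i, (1 + ‖i‖)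
    * (ν 0 k i + if i ∈ reachBox Δ d R b k then 1 else 0),
    Finset.sum_nonneg fun k _ => tsum_nonneg (hnn k), fun p => ?_⟩
  rw [flowDist, Finset.mul_sum]
  refine Finset.sum_le_sum fun k _ => ?_
  rw [wdist, ← tsum_mul_left]
  refine ((summable_wdist _ _).mul_left _).tsum_le_tsum (fun i => ?_) (summable_dominating _ _)
  have hp : (0 : ℝ) < p + 2 := by positivity
  have h1 : ((p : ℝ) + 2) * |ν (p + 1) k i - ν p k i| = |m p k i - ν p k i| := by
    nth_rewrite 1 [← abs_of_pos hp]
    rw [← abs_mul, mul_sub, h.average]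
    congr 1
    ring
  rw [mul_left_comm, h1]
  refine mul_le_mul_of_nonneg_left ?_ (by positivity)
  have h2 := h.le_dominating hb p k i
  have h3 := (ν p k).nonneg i
  have h4 := (m p k).nonneg i
  have h5 : m p k i ≤ ν 0 k i + if i ∈ reachBox Δ d R b k then 1 else 0 := by
    have := (ν 0 k).nonneg i
    split_ifs with hi
    · linarith [(m p k).le_one i]
    · rw [(h.response p).ce.eq_zero hb (h.response p).mem_controls k i hi]
      linarith
  rw [abs_le]
  constructor <;> linarith

theorem tendsto_flowDist_succ (h : IsLearning Δ L F G R m₀ ν v q m)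
    (hb : InitialSupport Δ m₀ b) :
    Tendsto (fun p => flowDist (ν (p + 1)) (ν p)) atTop (𝓝 0) := by
  obtain ⟨D, hD, hle⟩ := h.exists_flowDist_succ_le hb
  have hlim : Tendsto (fun p : ℕ => D / ((p : ℝ) + 2)) atTop (𝓝 0) :=
    tendsto_const_nhds.div_atTop
      (tendsto_atTop_add_const_right _ (2 : ℝ) tendsto_natCast_atTop_atTop)
  refine squeeze_zero (fun _ => flowDist_nonneg _ _) (fun p => ?_) hlim
  rw [le_div_iff₀ (by positivity), mul_comm]
  exact hle p

/-- Entries lie in `[0, 1]`, so they converge along an ultrafilter with no extraction of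
subsequences, and domination gives convergence in `flowDist`. Outside the box only `ν 0 / (p + 1)`
remains, so the limit is supported in the box even if the initial guess is not. -/
theorem exists_limit (h : IsLearning Δ L F G R m₀ ν v q m) (hb : InitialSupport Δ m₀ b)
    (u : Ultrafilter ℕ) (hu : (u : Filter ℕ) ≤ atTop) :
    ∃ ν' : Fin (Δ.N + 1) → GridProb d, (∀ k : Fin (Δ.N + 1), ∀ i ∉ reachBox Δ d R b k, ν' k i = 0) ∧
      Tendsto (fun p => flowDist (ν p) ν') u (𝓝 0) := by
  have hlim : ∀ k i, ∃ x, Tendsto (fun p => ν p k i) u (𝓝 x) := by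
    intro k i
    obtain ⟨x, -, hx⟩ := (isCompact_Icc (a := (0 : ℝ)) (b := 1)).ultrafilter_le_nhds
      (u.map fun p => ν p k i) (tendsto_principal.2
        (Eventually.of_forall fun p => ⟨(ν p k).nonneg i, (ν p k).le_one i⟩))
    exact ⟨x, hx⟩
  choose x hx using hlim
  have hzero : ∀ k, ∀ i ∉ reachBox Δ d R b (k : Fin (Δ.N + 1)), x k i = 0 := by
    intro k i hi
    have h1 : Tendsto (fun p : ℕ => ν 0 k i / ((p : ℝ) + 1)) atTop (𝓝 0) :=
      tendsto_const_nhds.div_atTop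
        (tendsto_atTop_add_const_right _ (1 : ℝ) tendsto_natCast_atTop_atTop)
    refine tendsto_nhds_unique (hx k i) ((h1.mono_left hu).congr fun p => ?_)
    have hp : (p : ℝ) + 1 ≠ 0 := by positivity
    rw [div_eq_iff hp, mul_comm, h.eq_sum, Finset.sum_eq_zero fun s _ =>
      (h.response s).ce.eq_zero hb (h.response s).mem_controls k i hi, add_zero]
  have hnn : ∀ k i, 0 ≤ x k i := fun k i => ge_of_tendsto' (hx k i) fun p => (ν p k).nonneg i
  have hsum : ∀ k, HasSum (x k) 1 := by
    intro k
    have hs : Summable fun i => ν 0 k i + if i ∈ reachBox Δ d R b k then (1 : ℝ) else 0 :=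
      (ν 0 k).hasSum.summable.add
        (summable_of_ne_finset_zero (s := reachBox Δ d R b k) fun i hi => by simp [hi])
    have := tendsto_tsum_of_dominated_convergence (𝓕 := (u : Filter ℕ))
      (f := fun p i => ν p k i) hs (hx k) (Eventually.of_forall fun p i => by
        rw [Real.norm_of_nonneg ((ν p k).nonneg i)]
        exact h.le_dominating hb p k i)
    simp only [(ν _ k).hasSum.tsum_eq] at this
    rw [tendsto_nhds_unique tendsto_const_nhds this]
    exact (summable_of_ne_finset_zero (hzero k)).hasSum
  let ν' : Fin (Δ.N + 1) → GridProb d := fun k => ⟨x k, hnn k, hsum k,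
    summable_of_ne_finset_zero fun i hi => by rw [hzero k i hi, mul_zero]⟩
  refine ⟨ν', hzero, ?_⟩
  unfold flowDist
  rw [← Finset.sum_const_zero (s := (Finset.univ : Finset (Fin (Δ.N + 1))))]
  refine tendsto_finsetSum _ fun k _ => tendsto_wdist_of_dominated
    (summable_dominating (ν 0 k) (reachBox Δ d R b k)) (Eventually.of_forall fun p i => ?_) (hx k)
  have h1 := h.le_dominating hb p k i
  have h2 : x k i ≤ ν 0 k i + if i ∈ reachBox Δ d R b k then 1 else 0 :=
    le_of_tendsto' (hx k i) fun p => h.le_dominating hb p k i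
  have h3 := (ν p k).nonneg i
  have h4 := hnn k i
  change |ν p k i - x k i| ≤ _
  rw [abs_le]
  constructor <;> linarith

/-- Along any ultrafilter `ν p` and `ν (p + 1)` have the same limit, so their responses both
converge to the response to that limit. Continuity together with compactness replaces uniform
continuity. -/
theorem tendsto_boxDist_succ (hS : IsRegularSystem Δ L F G R) (hb : InitialSupport Δ m₀ b)
    {z₀ : GridProb d} (hz₀ : ∀ i, z₀ i = m₀.1.real (cell Δ.dx i))
    (h : IsLearning Δ L F G R m₀ ν v q m) :
    Tendsto (fun p => boxDist Δ R b (m p) (m (p + 1))) atTop (𝓝 0) := by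
  rw [tendsto_iff_ultrafilter]
  intro u hu
  obtain ⟨ν', -, hν'⟩ := h.exists_limit hb u hu
  obtain ⟨v', q', m', hr⟩ := exists_isBestResponse hS hb hz₀ ν'
  have h1 : Tendsto (fun p => flowDist (ν (p + 1)) ν') u (𝓝 0) := by
    refine squeeze_zero (fun _ => flowDist_nonneg _ _)
      (fun p => flowDist_triangle (ν (p + 1)) (ν p) ν') ?_
    simpa using ((h.tendsto_flowDist_succ hb).mono_left hu).add hν'
  have h2 := tendsto_boxDist hS hb h.response hr hν'
  have h3 := tendsto_boxDist hS hb (fun p => h.response (p + 1)) hr h1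
  refine squeeze_zero (fun _ => boxDist_nonneg _ _)
    (fun p => boxDist_triangle_right (m p) (m (p + 1)) m') ?_
  simpa using h2.add h3

/-! ### The energy estimate -/

/-- The excess cost of the average of the responses, multiplied by their number. -/
def excess (Δ : Mesh T) (L : E d → E d → ℝ) (F G : E d → P1 d → ℝ) (R : ℝ) (m₀ : P1 d) (b : ℤ)
    (ν : ℕ → Fin (Δ.N + 1) → GridProb d) (v : ℕ → Fin (Δ.N + 1) → Idx d → ℝ)
    (q : ℕ → Fin Δ.N → Idx d → E d) (m : ℕ → Fin (Δ.N + 1) → GridProb d) (p : ℕ) : ℝ :=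
  ∑ s ∈ Finset.range p, controlCost Δ L R b (q s) (m s)
    + ((p : ℝ) + 1) * (couplingCost Δ F G (ν p) (ν p) - meanValue Δ m₀ b (v p))

/-- Sum the cost identity for the current `v p` over all past responses. Linearity collects their
coupling costs into that of the average, up to the contribution of `ν 0`. -/
theorem excess_eq (hS : IsRegularSystem Δ L F G R) (hb : InitialSupport Δ m₀ b)
    (h : IsLearning Δ L F G R m₀ ν v q m) (p : ℕ) :
    excess Δ L F G R m₀ b ν v q m p = ∑ s ∈ Finset.range p, gap Δ L R b (v p) (q s) (m s)
      + (couplingCost Δ F G (ν p) (ν 0) - meanValue Δ m₀ b (v p)) := by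
  have h1 : ∀ s, gap Δ L R b (v p) (q s) (m s) = controlCost Δ L R b (q s) (m s)
      + couplingCost Δ F G (ν p) (m s) - meanValue Δ m₀ b (v p) := fun s => by
    rw [cost_eq_meanValue_add_gap (h.response p).hjb hb (h.response s).mem_controls
      (h.response s).ce]
    ring
  have h2 := h.couplingCost_eq_sum hS p (ν p)
  rw [excess, mul_sub, h2]
  simp only [h1, Finset.sum_sub_distrib, Finset.sum_add_distrib, Finset.sum_const,
    Finset.card_range, nsmul_eq_mul]
  ring

/-- By linearity (`e5`) the increment is `(p + 2)` times the change of coupling cost at `ν (p + 1)`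
plus the drop in mean value. Monotonicity (`e14`) replaces `ν (p + 1)` by `m p` in the first term,
and suboptimality of `m (p + 1)` for `ν p` (`e12`) bounds the second. What remains is a mixed
difference. -/
theorem exists_excess_succ_le (hS : IsRegularSystem Δ L F G R) (hb : InitialSupport Δ m₀ b)
    (h : IsLearning Δ L F G R m₀ ν v q m) :
    ∃ K, 0 ≤ K ∧ ∀ p, excess Δ L F G R m₀ b ν v q m (p + 1)
      ≤ excess Δ L F G R m₀ b ν v q m p + K * boxDist Δ R b (m p) (m (p + 1)) := by
  obtain ⟨K, hK, hlip⟩ := exists_couplingCost_lipschitz (F := F) (G := G) hS hb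
  obtain ⟨D, hD, hflow⟩ := h.exists_flowDist_succ_le hb
  refine ⟨K * D, by positivity, fun p => ?_⟩
  have hr := h.response p
  have hr' := h.response (p + 1)
  have e1 := hr.meanValue_eq hb
  have e2 := hr'.meanValue_eq hb
  have e3 := cost_eq_meanValue_add_gap hr.hjb hb hr'.mem_controls hr'.ce
  have e4 := gap_nonneg (b := b) hS.lagrangian (v := v p) hr'.mem_controls (m (p + 1))
  have e5 := couplingCost_linear hS (h.average p) (ν p)
  have e6 := couplingCost_linear hS (h.average p) (ν (p + 1))
  have e7 := couplingCost_monotone hS (ν (p + 1)) (ν p)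
  have e8 := hlip (ν (p + 1)) (ν p) _ _ _ _ hr.mem_controls hr'.mem_controls hr.ce hr'.ce
  have hp : (0 : ℝ) ≤ (p : ℝ) + 2 := by positivity
  have e9 : ((p : ℝ) + 2) * (K * flowDist (ν (p + 1)) (ν p) * boxDist Δ R b (m p) (m (p + 1)))
      ≤ K * D * boxDist Δ R b (m p) (m (p + 1)) := by
    have := mul_le_mul_of_nonneg_right (mul_le_mul_of_nonneg_left (hflow p) hK)
      (boxDist_nonneg (Δ := Δ) (R := R) (b := b) (m p) (m (p + 1)))
    linarith
  have e10 := mul_le_mul_of_nonneg_left e8 hp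
  have e11 : 0 ≤ ((p : ℝ) + 1) * _ := mul_nonneg (by positivity) e7
  have e12 : 0 ≤ ((p : ℝ) + 2) * _ := mul_nonneg hp e4
  simp only [excess, Finset.sum_range_succ, Nat.cast_add, Nat.cast_one]
  rw [e1, e2]
  rw [e1] at e3
  have e13 : gap Δ L R b (v p) (q (p + 1)) (m (p + 1))
    = controlCost Δ L R b (q (p + 1)) (m (p + 1)) + couplingCost Δ F G (ν p) (m (p + 1))
      - (controlCost Δ L R b (q p) (m p) + couplingCost Δ F G (ν p) (m p)) := by linarith
  rw [e13] at e12
  have e14 : couplingCost Δ F G (ν (p + 1)) (ν (p + 1)) - couplingCost Δ F G (ν p) (ν (p + 1))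
      ≤ couplingCost Δ F G (ν (p + 1)) (m p) - couplingCost Δ F G (ν p) (m p) := by linarith
  have e15 := mul_le_mul_of_nonneg_left e14 hp
  linarith

theorem tendsto_mean_gap (hS : IsRegularSystem Δ L F G R) (hb : InitialSupport Δ m₀ b)
    {z₀ : GridProb d} (hz₀ : ∀ i, z₀ i = m₀.1.real (cell Δ.dx i))
    (h : IsLearning Δ L F G R m₀ ν v q m) :
    Tendsto (fun p : ℕ => (p : ℝ)⁻¹ * ∑ s ∈ Finset.range p, gap Δ L R b (v p) (q s) (m s))
      atTop (𝓝 0) := by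
  obtain ⟨K, hK, hstep⟩ := h.exists_excess_succ_le hS hb
  obtain ⟨C, hC⟩ := exists_abs_couplingCost_le hS
  have hr := h.response 0
  -- One `C` bounds the coupling cost of `ν 0`. The last bracket bounds the mean value of every `v
  -- p`, since `q 0` is an admissible competitor.
  let c := excess Δ L F G R m₀ b ν v q m 0 + C + (controlCost Δ L R b (q 0) (m 0) + C)
  have hexc : ∀ p, excess Δ L F G R m₀ b ν v q m p ≤ excess Δ L F G R m₀ b ν v q m 0
      + K * ∑ s ∈ Finset.range p, boxDist Δ R b (m s) (m (s + 1)) := by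
    intro p
    induction p with
    | zero => simp
    | succ p ih =>
      rw [Finset.sum_range_succ, mul_add]
      linarith [hstep p]
  have hle : ∀ p, ∑ s ∈ Finset.range p, gap Δ L R b (v p) (q s) (m s)
      ≤ c + K * ∑ s ∈ Finset.range p, boxDist Δ R b (m s) (m (s + 1)) := by
    intro p
    have h1 := h.excess_eq hS hb p
    have h2 := cost_eq_meanValue_add_gap (h.response p).hjb hb hr.mem_controls hr.ce
    have h3 := gap_nonneg (b := b) hS.lagrangian (v := v p) hr.mem_controls (m 0)
    have h4 := (abs_le.1 (hC (ν p) (m 0))).2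
    have h5 := (abs_le.1 (hC (ν p) (ν 0))).1
    have h6 := hexc p
    simp only [c]
    linarith
  have hces := (h.tendsto_boxDist_succ hS hb hz₀).cesaro
  refine squeeze_zero (g := fun p : ℕ => (p : ℝ)⁻¹ * c
    + K * ((p : ℝ)⁻¹ * ∑ s ∈ Finset.range p, boxDist Δ R b (m s) (m (s + 1)))) (fun p => ?_)
    (fun p => ?_) ?_
  · exact mul_nonneg (by positivity) (Finset.sum_nonneg fun s _ =>
      gap_nonneg hS.lagrangian (h.response s).mem_controls _)
  · have := mul_le_mul_of_nonneg_left (hle p) (show (0 : ℝ) ≤ (p : ℝ)⁻¹ by positivity)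
    linarith
  · simpa using ((tendsto_inv_atTop_nhds_zero_nat (𝕜 := ℝ)).mul_const c).add (hces.const_mul K)

/-- The mean gap for `v p` tends to 0, and `v p` tends uniformly to `v'` along `u`, so the mean gap
for `v'` does too. The stability estimate is affine in the gap and can be averaged over past
responses: their mean, which is asymptotically `ν p`, tends to `m'`. -/
theorem limit_eq_response (hS : IsRegularSystem Δ L F G R) (hb : InitialSupport Δ m₀ b)
    {z₀ : GridProb d} (hz₀ : ∀ i, z₀ i = m₀.1.real (cell Δ.dx i))
    (h : IsLearning Δ L F G R m₀ ν v q m) {u : Filter ℕ} [u.NeBot] (hu : u ≤ atTop)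
    {ν' m' : Fin (Δ.N + 1) → GridProb d} {v' : Fin (Δ.N + 1) → Idx d → ℝ}
    {q' : Fin Δ.N → Idx d → E d} (hzero : ∀ k : Fin (Δ.N + 1), ∀ i ∉ reachBox Δ d R b k, ν' k i = 0)
    (hlim : Tendsto (fun p => flowDist (ν p) ν') u (𝓝 0))
    (hr : IsBestResponse Δ L F G R m₀ ν' v' q' m') : ν' = m' := by
  obtain ⟨K, hK, hlip⟩ := exists_solvesHJB_lipschitz hS
  funext k
  refine GridProb.ext (funext fun i => ?_)
  by_cases hi : i ∈ reachBox Δ d R b k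
  swap
  · rw [hzero k i hi, hr.ce.eq_zero hb hr.mem_controls k i hi]
  have hinv : Tendsto (fun p : ℕ => (p : ℝ)⁻¹) u (𝓝 0) :=
    (tendsto_inv_atTop_nhds_zero_nat (𝕜 := ℝ)).mono_left hu
  have hg := (hinv.add ((h.tendsto_mean_gap hS hb hz₀).mono_left hu)).add
    (hlim.const_mul (Δ.N * (2 * K)))
  simp only [add_zero, mul_zero] at hg
  have h1 : Tendsto (fun p => |ν p k i - m' k i|) u (𝓝 0) := by
    refine tendsto_zero_of_le_add_mul (Eventually.of_forall fun _ => abs_nonneg _) hg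
      fun η hη => ?_
    obtain ⟨C, hC0, hC⟩ := exists_transport_stability hS hb hr.hjb hr.opt hr.ce hη
    -- The summand 1 absorbs the term `1 / p` left by the initial guess; `C` multiplies the mean gap
    -- and the distance of the value functions.
    refine ⟨1 + C, ((eventually_ge_atTop 1).filter_mono hu).mono fun p hp => ?_⟩
    have hp0 : (0 : ℝ) < p := by exact_mod_cast hp
    have hterm : ∀ s, |m s k i - m' k i| ≤ η + C * (gap Δ L R b (v p) (q s) (m s)
        + Δ.N * (2 * (K * flowDist (ν p) ν'))) := by
      intro s
      have h2 := hC _ _ (h.response s).mem_controls (h.response s).ce k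
      have h3 := gap_le_gap_add (b := b) hS.lagrangian hS.pos (v := v') (v' := v p)
        (ε := K * flowDist (ν p) ν') (fun k i => by
          rw [abs_sub_comm]; exact hlip _ _ _ _ (h.response p).hjb hr.hjb k i) (q s) (m s)
      have h4 := Finset.single_le_sum (f := fun i => |m s k i - m' k i|)
        (fun _ _ => abs_nonneg _) hi
      have h5 := mul_le_mul_of_nonneg_left h3 hC0
      linarith
    have hsum : (p : ℝ) * |ν p k i - m' k i| ≤ 1 + (p * η
        + C * (∑ s ∈ Finset.range p, gap Δ L R b (v p) (q s) (m s)
          + p * (Δ.N * (2 * (K * flowDist (ν p) ν'))))) := by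
      -- There are `p` responses but the total weight is `p + 1`, whence the correction `ν 0 - ν p`,
      -- at most 1 in absolute value.
      have e : (p : ℝ) * (ν p k i - m' k i)
          = (ν 0 k i - ν p k i) + ∑ s ∈ Finset.range p, (m s k i - m' k i) := by
        have := h.eq_sum p k i
        rw [Finset.sum_sub_distrib, Finset.sum_const, Finset.card_range, nsmul_eq_mul]
        linarith
      rw [← abs_of_pos hp0, ← abs_mul, abs_of_pos hp0, e]
      refine (abs_add_le _ _).trans (add_le_add ?_ ((Finset.abs_sum_le_sum_abs _ _).trans
        ((Finset.sum_le_sum fun s _ => hterm s).trans (le_of_eq ?_))))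
      · have a1 := (ν 0 k).nonneg i
        have a2 := (ν 0 k).le_one i
        have a3 := (ν p k).nonneg i
        have a4 := (ν p k).le_one i
        rw [abs_le]
        constructor <;> linarith
      · simp only [Finset.sum_add_distrib, ← Finset.mul_sum, Finset.sum_const, Finset.card_range,
          nsmul_eq_mul]
        ring
    have hmul := mul_le_mul_of_nonneg_left hsum (inv_nonneg.2 hp0.le)
    rw [inv_mul_cancel_left₀ hp0.ne'] at hmul
    have hf := flowDist_nonneg (ν p) ν'
    have hgap : 0 ≤ (p : ℝ)⁻¹ * ∑ s ∈ Finset.range p, gap Δ L R b (v p) (q s) (m s) :=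
      mul_nonneg (inv_nonneg.2 hp0.le) (Finset.sum_nonneg fun s _ =>
        gap_nonneg hS.lagrangian (h.response s).mem_controls _)
    have hip : 0 ≤ (p : ℝ)⁻¹ := inv_nonneg.2 hp0.le
    have hCi : 0 ≤ C * (p : ℝ)⁻¹ := by positivity
    have hNK : 0 ≤ Δ.N * (2 * K) * flowDist (ν p) ν' := by positivity
    have hcancel : (p : ℝ)⁻¹ * (1 + (p * η
        + C * (∑ s ∈ Finset.range p, gap Δ L R b (v p) (q s) (m s)
          + p * (Δ.N * (2 * (K * flowDist (ν p) ν'))))))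
        = (p : ℝ)⁻¹ + η + C * ((p : ℝ)⁻¹ * (∑ s ∈ Finset.range p, gap Δ L R b (v p) (q s) (m s))
          + Δ.N * (2 * K) * flowDist (ν p) ν') := by
      field_simp
      ring
    rw [hcancel] at hmul
    linarith
  have h2 : Tendsto (fun p => |ν p k i - ν' k i|) u (𝓝 0) :=
    squeeze_zero (fun _ => abs_nonneg _)
      (fun p => (abs_sub_le_wdist _ _ i).trans (wdist_le_flowDist _ _ k)) hlim
  have h3 : ∀ {y : ℝ}, Tendsto (fun p => |ν p k i - y|) u (𝓝 0) → Tendsto (fun p => ν p k i) u (𝓝 y) :=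
    fun hy => tendsto_iff_dist_tendsto_zero.2 hy
  exact tendsto_nhds_unique (h3 h2) (h3 h1)

theorem tendsto_flowDist (hS : IsRegularSystem Δ L F G R) (hb : InitialSupport Δ m₀ b)
    {z₀ : GridProb d} (hz₀ : ∀ i, z₀ i = m₀.1.real (cell Δ.dx i))
    (h : IsLearning Δ L F G R m₀ ν v q m)
    {m' : Fin (Δ.N + 1) → GridProb d} {v' : Fin (Δ.N + 1) → Idx d → ℝ}
    {q' : Fin Δ.N → Idx d → E d} (hr : IsBestResponse Δ L F G R m₀ m' v' q' m') :
    Tendsto (fun p => flowDist (ν p) m') atTop (𝓝 0) := by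
  rw [tendsto_iff_ultrafilter]
  intro u hu
  obtain ⟨ν', hzero, hν'⟩ := h.exists_limit hb u hu
  obtain ⟨w, r, μ, hw⟩ := exists_isBestResponse hS hb hz₀ ν'
  have heq := h.limit_eq_response hS hb hz₀ hu hzero hν' hw
  subst heq
  rwa [solution_unique hS hb hr hw] at hν'

end IsLearning

/-- Any limit point of the iteration is a solution; the iteration may start from any flow, here the
constant one. -/
theorem exists_solution (hS : IsRegularSystem Δ L F G R) (hb : InitialSupport Δ m₀ b)
    {z₀ : GridProb d} (hz₀ : ∀ i, z₀ i = m₀.1.real (cell Δ.dx i)) :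
    ∃ v q m, IsBestResponse Δ L F G R m₀ m v q m := by
  obtain ⟨ν, v, q, m, -, h⟩ := exists_isLearning hS hb hz₀ fun _ => z₀
  obtain ⟨u, hu⟩ := Ultrafilter.exists_le (atTop : Filter ℕ)
  obtain ⟨ν', hzero, hν'⟩ := h.exists_limit hb u hu
  obtain ⟨w, r, μ, hw⟩ := exists_isBestResponse hS hb hz₀ ν'
  have heq := h.limit_eq_response hS hb hz₀ hu hzero hν' hw
  exact ⟨w, r, ν', heq ▸ hw⟩

/-! ### Reduction to the regular system and change of indices -/

theorem isRegularSystem (hR : 0 < R) (hFbdd : RunningBounds F) (hGbdd : TerminalBounds G)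
    (hL : LagrangianAssumptions L) (hFmono : DiscreteMonotone Δ F) (hGmono : DiscreteMonotone Δ G)
    (hunique : UniqueControls Δ L F G R) (hFlip : LipschitzInMeasure F)
    (hGlip : LipschitzInMeasure G) : IsRegularSystem Δ L F G R := by
  refine ⟨hR, hL, fun k => ?_, hunique⟩
  obtain ⟨C, hC, _, _, hF⟩ := hFbdd
  obtain ⟨_, _, C', hC', hG⟩ := hGbdd
  have h1 := (isMonotoneCoupling_onGrid Δ hC.le (fun x μ => (hF μ).1 x) hFlip hFmono).const_mul
    Δ.dt_pos.le
  have h2 := isMonotoneCoupling_onGrid Δ hC'.le (fun x μ => by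
    have := (hG μ).2.2 x
    have a1 := norm_nonneg (fderiv ℝ (fun y => G y μ) x)
    have a2 := norm_nonneg (fderiv ℝ (fderiv ℝ (fun y => G y μ)) x)
    linarith) hGlip hGmono
  by_cases hk : k = Fin.last Δ.N
  · have : coupling Δ F G k = onGrid Δ G := by funext i z; exact if_pos hk
    rwa [this]
  · have : coupling Δ F G k = fun i z => Δ.dt * onGrid Δ F i z := by funext i z; exact if_neg hk
    rwa [this]

/-- The iteration with its original indices, and the one indexed from `0`. -/
theorem IsDLVI.isLearning (h : IsDLVI Δ L F G m₀ R q v m ν) :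
    IsLearning Δ L F G R m₀ (fun p => ν (p + 1)) (fun p => v (p + 1)) (fun p => q (p + 1))
      (fun p => m (p + 2)) := by
  refine ⟨fun p => ?_, fun p k i => ?_⟩
  · obtain ⟨h1, h2, h3, -⟩ := h (p + 1) (by omega)
    exact ⟨h1, h2, h3⟩
  · have := (h (p + 1) (by omega)).2.2.2 k i
    have hp : (p : ℝ) + 1 + 1 ≠ 0 := by positivity
    push_cast at this
    rw [this]
    field_simp
    ring

/-- Truncated subtraction affects only the entries of index 0 and `m 1`, on which `IsDLVI` imposes
nothing. -/
theorem IsLearning.isDLVI (h : IsLearning Δ L F G R m₀ ν v q m) :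
    IsDLVI Δ L F G m₀ R (fun n => q (n - 1)) (fun n => v (n - 1)) (fun n => m (n - 2))
      (fun n => ν (n - 1)) := by
  intro n hn
  obtain ⟨p, rfl⟩ := Nat.exists_eq_add_of_le' hn
  have hr := h.response p
  refine ⟨hr.hjb, hr.opt, hr.ce, fun k i => ?_⟩
  have := h.average p k i
  have hp : (p : ℝ) + 2 ≠ 0 := by positivity
  have hp' : (p : ℝ) + 1 + 1 ≠ 0 := by positivity
  simp only [Nat.add_sub_cancel, Nat.cast_add, Nat.cast_one]
  refine mul_left_cancel₀ hp ?_
  rw [this]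
  simp only [Nat.reduceSubDiff]
  field_simp
  ring

end

end MFGDiscrete

end

/-! ### The main theorem -/

theorem mainTheorem2 (d : ℕ) (T : ℝ) (Δ : MFGDiscrete.Mesh T)
    (F G : MFGDiscrete.E d → MFGDiscrete.P1 d → ℝ)
    (L : MFGDiscrete.E d → MFGDiscrete.E d → ℝ)
    (m₀ : MFGDiscrete.P1 d) (C_H : ℝ) (hC_H : 0 < C_H)
    (hFcont : MFGDiscrete.JointlyContinuous F) (hGcont : MFGDiscrete.JointlyContinuous G)
    (hFbdd : MFGDiscrete.RunningBounds F) (hGbdd : MFGDiscrete.TerminalBounds G)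
    (hinit : MFGDiscrete.RegularInitial m₀)
    (hL : MFGDiscrete.LagrangianAssumptions L)
    (hFmono : MFGDiscrete.DiscreteMonotone Δ F) (hGmono : MFGDiscrete.DiscreteMonotone Δ G)
    (hmesh : ∃ c > 0, Δ.dx < c * Δ.dt)
    (hunique : MFGDiscrete.UniqueControls Δ L F G C_H)
    (hFlip : MFGDiscrete.LipschitzInMeasure F) (hGlip : MFGDiscrete.LipschitzInMeasure G) :
    ∃ (q : Fin Δ.N → MFGDiscrete.Idx d → MFGDiscrete.E d)
      (v : Fin (Δ.N + 1) → MFGDiscrete.Idx d → ℝ)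
      (m : Fin (Δ.N + 1) → MFGDiscrete.GridProb d),
      -- `(m, v)` is the unique solution of the discrete system
      MFGDiscrete.SolvesMFG Δ L F G m₀ C_H m v ∧
      (∀ m' v', MFGDiscrete.SolvesMFG Δ L F G m₀ C_H m' v' → m' = m ∧ v' = v) ∧
      -- `q` is its unique optimal control
      MFGDiscrete.optFeedbacks Δ L C_H v = {q} ∧
      ∀ mbar₁ : Fin (Δ.N + 1) → MFGDiscrete.GridProb d,
        -- the iteration can be run from any initial guess
        (∃ qn vn mn mbarn, mbarn 1 = mbar₁ ∧
          MFGDiscrete.IsDLVI Δ L F G m₀ C_H qn vn mn mbarn) ∧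
        -- and it converges to `(q, v, m, m)`
        ∀ qn vn mn mbarn, mbarn 1 = mbar₁ →
          MFGDiscrete.IsDLVI Δ L F G m₀ C_H qn vn mn mbarn →
          (∀ k i, Tendsto (fun n => qn n k i) atTop (𝓝 (q k i))) ∧
          (∀ k, TendstoUniformly (fun n i => vn n k i) (fun i => v k i) atTop) ∧
          (∀ k, Tendsto (fun n => ∑' i, |mn n k i - m k i|) atTop (𝓝 0)) ∧
          (∀ k, Tendsto (fun n => ∑' i, |mbarn n k i - m k i|) atTop (𝓝 0)) := by
  have hS := MFGDiscrete.isRegularSystem (Δ := Δ) hC_H hFbdd hGbdd hL hFmono hGmono hunique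
    hFlip hGlip
  obtain ⟨z₀, b, hz₀, hz⟩ := MFGDiscrete.exists_initial Δ hinit
  have hb : MFGDiscrete.InitialSupport Δ m₀ b := fun i hi => (hz₀ i).symm.trans (hz i hi)
  obtain ⟨v, q, m, hr⟩ := MFGDiscrete.exists_solution hS hb hz₀
  refine ⟨q, v, m, MFGDiscrete.solvesMFG_iff.2 ⟨q, hr⟩, fun m' v' h' => ?_,
    MFGDiscrete.optFeedbacks_eq_singleton hS hr.hjb hr.opt, fun mbar₁ => ⟨?_, ?_⟩⟩
  · obtain ⟨q', hr'⟩ := MFGDiscrete.solvesMFG_iff.1 h'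
    have hm := MFGDiscrete.solution_unique hS hb hr hr'
    subst hm
    exact ⟨rfl, hr'.hjb.unique hS hr.hjb⟩
  · obtain ⟨νn, vn, qn, mn, h0, h⟩ := MFGDiscrete.exists_isLearning hS hb hz₀ mbar₁
    exact ⟨_, _, _, _, h0, h.isDLVI⟩
  · intro qn vn mn mbarn _ hD
    have h := hD.isLearning
    have hlim := h.tendsto_flowDist hS hb hz₀ hr
    refine ⟨fun k i => ?_, fun k => ?_, fun k => ?_, fun k => ?_⟩
    · exact (tendsto_add_atTop_iff_nat 1).1
        (MFGDiscrete.tendsto_control hS h.response hr hlim k i)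
    · have := MFGDiscrete.tendstoUniformly_value hS (fun p => (h.response p).hjb) hr.hjb hlim k
      rw [Metric.tendstoUniformly_iff] at this ⊢
      intro ε hε
      obtain ⟨n₀, hn₀⟩ := eventually_atTop.1 (this ε hε)
      filter_upwards [eventually_ge_atTop (n₀ + 1)] with n hn i
      obtain ⟨p, rfl⟩ := Nat.exists_eq_add_of_le' (show 1 ≤ n by omega)
      exact hn₀ p (by omega) i
    -- The shift is 2 because `mn (p + 2)` is the response to `mbarn (p + 1)`. Responses and limit
    -- are supported in the boxes, so the series is one summand of `boxDist`.
    · refine (tendsto_add_atTop_iff_nat 2).1 (squeeze_zero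
        (fun p => tsum_nonneg fun i => abs_nonneg _) (fun p => ?_)
        (MFGDiscrete.tendsto_boxDist hS hb h.response hr hlim))
      rw [tsum_eq_sum (s := MFGDiscrete.reachBox Δ d C_H b k) fun i hi => by
        rw [(h.response p).ce.eq_zero hb (h.response p).mem_controls k i hi,
          hr.ce.eq_zero hb hr.mem_controls k i hi, sub_zero, abs_zero]]
      exact Finset.single_le_sum (f := fun k : Fin (Δ.N + 1) =>
        ∑ i ∈ MFGDiscrete.reachBox Δ d C_H b k, |mn (p + 2) k i - m k i|)
        (fun _ _ => Finset.sum_nonneg fun _ _ => abs_nonneg _) (Finset.mem_univ k)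
    · exact (tendsto_add_atTop_iff_nat 1).1 (squeeze_zero
        (fun p => tsum_nonneg fun i => abs_nonneg _)
        (fun p => (MFGDiscrete.tsum_abs_sub_le_wdist _ _).trans
          (MFGDiscrete.wdist_le_flowDist _ _ k)) hlim)
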